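/- Let $m\ge 2$, let $\gamma_1,\dots,\gamma_m,c\in\mathbb R^2$, write $\Gamma=(\gamma_1,\dots,\gamma_m)$, and consider $\mathcal R_\Gamma=\{u\in\mathbb R^m:\sum_k\gamma_k u_k^2=c\}$ (an intersection of two quadrics). Call $(\Gamma,c)$ admissible if (a) $c$ lies in the cone generated by $\gamma_1,\dots,\gamma_m$, (b) $c$ lies in no cone generated by fewer than two of the $\gamma_k$, and (c) $\gamma_1,\dots,\gamma_m$ generate a lattice $L$ (a discrete subgroup) in $\mathbb R^2$. Then $\mathcal R_\Gamma$ is a nonempty smooth $(m-2)$-dimensional manifold. Let $L^*$ be the dual lattice, $$T_\Gamma=\{(e^{2\pi i\langle\gamma_1,\varphi\rangle},\dots,e^{2\pi i\langle\gamma_m,\varphi\rangle}):\varphi\in\mathbb R^2\}\cong\mathbb R^2/L^*,$$ and let $D_\Gamma=\tfrac12L^*/L^*\subset T_\Gamma$, which consists of vectors of signs and acts coordinatewise on $\mathcal R_\Gamma$ and on $T_\Gamma$. Let $N_\Gamma=\mathcal R_\Gamma\times_{D_\Gamma}T_\Gamma$ be the quotient of $\mathcal R_\Gamma\times T_\Gamma$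 by the (free) diagonal action of $D_\Gamma$, an $m$-dimensional smooth manifold, and let $i_\Gamma:N_\Gamma\to\mathbb C^m$ be the map induced by $(u,t)\mapsto(u_1t_1,\dots,u_mt_m)$. For integers $p,q\ge1$ and $0\le k\le p$ let $$N_k(p,q)=(S^{p-1}\times S^{q-1})\times_{\mathbb Z/2\times\mathbb Z/2}(S^1\times S^1),$$ the quotient manifold of $S^{p-1}\times S^{q-1}\times S^1\times S^1$ by the group generated by the two commuting involutions $$(x,y,s,t)\mapsto(-x,\,y,\,-s,\,t),\qquad (x,y,s,t)\mapsto\bigl((-x_1,\dots,-x_k,x_{k+1},\dots,x_p),\,-y,\,s,\,-t\bigr).$$ Theorem. Let $(\Gamma,c)$ be admissible, and suppose that $N_\Gamma$ is compact and that $i_\Gamma:N_\Gamma\to\mathbb C^m$ is a smooth embedding. Then $N_\Gamma$ is diffeomorphic to $N_k(p,q)$ for some integers $k,p,q$ with $p+q=m$, $0<p<m$ and $0\le k\le p$. Conversely, for every triple $(k,p,q)$ with $p+q=m$, $0<p<m$ and $0\le k\le p$ there is an admissible $(\Gamma,c)$ such that $N_\Gamma$ is compact, $i_\Gamma$ is a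 smooth embedding, and $N_\Gamma$ is diffeomorphic to $N_k(p,q)$. -/

import Mathlib

open scoped ContDiff Manifold Topology Matrix

noncomputable section

section SmoothStructure

variable {E : Type*} [NormedAddCommGroup E] [NormedSpace ℝ E]
  {X : Type*} {N : Type*} [TopologicalSpace N]

/-- Let `X` be a subset of a Euclidean space `E` (through `ι : X → E`) and `π : X → N` a projection.
A chart `e` of `N` with values in `ℝ^d` is *smooth* if `π` is a local diffeomorphism in this chart:
`e ∘ π` is smooth, that is, near each point it is the restriction of a smooth map defined on an open
subset of `E`, and `e.symm` lifts, near each point of its domain, through `π` to a map into `X` that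
is smooth as a map into `E`. -/
def smoothCharts (ι : X → E) (π : X → N) (d : ℕ) :
    Set (OpenPartialHomeomorph N (EuclideanSpace ℝ (Fin d))) :=
  {e | (∀ x : X, π x ∈ e.source → ∃ (U : Set E) (F : E → EuclideanSpace ℝ (Fin d)),
          IsOpen U ∧ ι x ∈ U ∧ ContDiffOn ℝ ∞ F U ∧
          ∀ y : X, ι y ∈ U → π y ∈ e.source → F (ι y) = e (π y)) ∧
       (∀ v ∈ e.target, ∃ (W : Set (EuclideanSpace ℝ (Fin d))) (s : EuclideanSpace ℝ (Fin d) → X),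
          IsOpen W ∧ v ∈ W ∧ W ⊆ e.target ∧ ContDiffOn ℝ ∞ (ι ∘ s) W ∧
          ∀ w ∈ W, π (s w) = e.symm w)}

/-- The smooth structure on `N` for which `π : X → N` is a local diffeomorphism: its charts are all
smooth charts. -/
@[reducible] def smoothQuotientChartedSpace (ι : X → E) (π : X → N) (d : ℕ)
    (h : ∀ n : N, ∃ e ∈ smoothCharts ι π d, n ∈ e.source) :
    ChartedSpace (EuclideanSpace ℝ (Fin d)) N where
  atlas := smoothCharts ι π d
  chartAt n := (h n).choose
  mem_chart_source n := (h n).choose_spec.2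
  chart_mem_atlas n := (h n).choose_spec.1

/-- Smooth charts are smoothly compatible. -/
theorem smoothQuotient_isManifold (ι : X → E) (π : X → N) (d : ℕ)
    (h : ∀ n : N, ∃ e ∈ smoothCharts ι π d, n ∈ e.source) :
    @IsManifold ℝ _ (EuclideanSpace ℝ (Fin d)) _ _ _ _ 𝓘(ℝ, EuclideanSpace ℝ (Fin d)) ∞ N _
      (smoothQuotientChartedSpace ι π d h) := by
  let _ := smoothQuotientChartedSpace ι π d h
  refine isManifold_of_contDiffOn _ _ _ fun e e' he he' => ?_
  have he : e ∈ smoothCharts ι π d := he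
  have he' : e' ∈ smoothCharts ι π d := he'
  rintro v ⟨hv, -⟩
  have hv : v ∈ (e.symm ≫ₕ e').source := hv
  rw [OpenPartialHomeomorph.trans_source] at hv
  obtain ⟨hv1, hv2⟩ := hv
  simp only [OpenPartialHomeomorph.symm_source, Set.mem_preimage] at hv1 hv2
  obtain ⟨W, s, hW, hvW, hWt, hs, hπ⟩ := he.2 v hv1
  obtain ⟨U, F, hU, hxU, hF, hFe⟩ := he'.1 (s v) (by rw [hπ v hvW]; exact hv2)
  apply ContDiffAt.contDiffWithinAt
  have hsv : ContDiffAt ℝ ∞ (ι ∘ s) v := hs.contDiffAt (hW.mem_nhds hvW)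
  have hc : ContDiffAt ℝ ∞ (F ∘ (ι ∘ s)) v :=
    ContDiffAt.comp v (hF.contDiffAt (hU.mem_nhds hxU)) hsv
  refine hc.congr_of_eventuallyEq ?_
  have h1 : ∀ᶠ w in 𝓝 v, (ι ∘ s) w ∈ U := hsv.continuousAt.eventually (hU.mem_nhds hxU)
  have h2 : ∀ᶠ w in 𝓝 v, e.symm w ∈ e'.source :=
    (e.symm.continuousAt hv1).eventually (e'.open_source.mem_nhds hv2)
  filter_upwards [h1, h2, hW.mem_nhds hvW] with w hw1 hw2 hw3
  have := hFe (s w) hw1 (by rw [hπ w hw3]; exact hw2)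
  simp only [Function.comp_apply] at this ⊢
  rw [this, hπ w hw3]
  rfl

/-- Near `x`, the subset `X` of `E` is a smooth submanifold modelled on `V`: a neighbourhood of `x`
in `X` is diffeomorphic to an open subset of `V`. -/
def HasLocalParam (ι : X → E) (V : Type*) [NormedAddCommGroup V] [NormedSpace ℝ V] (x : X) :
    Prop :=
  ∃ (U : Set E) (W : Set V) (ψ : E → V) (s : V → X), IsOpen U ∧ IsOpen W ∧ ι x ∈ U ∧
    ContDiffOn ℝ ∞ ψ U ∧ ContDiffOn ℝ ∞ (ι ∘ s) W ∧
    (∀ y, ι y ∈ U → ψ (ι y) ∈ W ∧ s (ψ (ι y)) = y) ∧ (∀ w ∈ W, ι (s w) ∈ U ∧ ψ (ι (s w)) = w)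

theorem HasLocalParam.congr {ι : X → E} {V V' : Type*} [NormedAddCommGroup V] [NormedSpace ℝ V]
    [NormedAddCommGroup V'] [NormedSpace ℝ V'] {x : X} (h : HasLocalParam ι V x)
    (L : V ≃L[ℝ] V') : HasLocalParam ι V' x := by
  obtain ⟨U, W, ψ, s, hU, hW, hx, hψ, hs, h1, h2⟩ := h
  refine ⟨U, L.symm ⁻¹' W, L ∘ ψ, s ∘ L.symm, hU, hW.preimage L.symm.continuous, hx,
    L.contDiff.comp_contDiffOn hψ, ?_, fun y hy => ?_, fun w hw => ?_⟩
  · exact ContDiffOn.comp (g := ι ∘ s) hs L.symm.contDiff.contDiffOn (fun w hw => hw)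
  · simpa using h1 y hy
  · have := h2 _ hw
    simp only [Function.comp_apply]
    exact ⟨this.1, by rw [this.2]; simp⟩

theorem HasLocalParam.prodMap {E' : Type*} [NormedAddCommGroup E'] [NormedSpace ℝ E']
    {X' : Type*} {ι : X → E} {ι' : X' → E'}
    {V V' : Type*} [NormedAddCommGroup V] [NormedSpace ℝ V]
    [NormedAddCommGroup V'] [NormedSpace ℝ V'] {x : X} {x' : X'}
    (h : HasLocalParam ι V x) (h' : HasLocalParam ι' V' x') :
    HasLocalParam (Prod.map ι ι') (V × V') (x, x') := by
  obtain ⟨U, W, ψ, s, hU, hW, hx, hψ, hs, h1, h2⟩ := h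
  obtain ⟨U', W', ψ', s', hU', hW', hx', hψ', hs', h1', h2'⟩ := h'
  refine ⟨U ×ˢ U', W ×ˢ W', Prod.map ψ ψ', Prod.map s s', hU.prod hU', hW.prod hW', ⟨hx, hx'⟩,
    hψ.prodMap hψ', hs.prodMap hs', ?_, ?_⟩
  · rintro ⟨y, y'⟩ ⟨hy, hy'⟩
    exact ⟨⟨(h1 y hy).1, (h1' y' hy').1⟩, Prod.ext (h1 y hy).2 (h1' y' hy').2⟩
  · rintro ⟨y, y'⟩ ⟨hy, hy'⟩
    exact ⟨⟨(h2 y hy).1, (h2' y' hy').1⟩, Prod.ext (h2 y hy).2 (h2' y' hy').2⟩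

/-- Implicit function theorem: regular level sets are submanifolds. -/
theorem hasLocalParam_levelSet [FiniteDimensional ℝ E] {F : Type*} [NormedAddCommGroup F]
    [NormedSpace ℝ F] [FiniteDimensional ℝ F] (d : ℕ) {ι : X → E}
    (hι : Function.Injective ι) {f : E → F} (hf : ContDiff ℝ ∞ f) (hr : Set.range ι = f ⁻¹' {0})
    (x : X) (hx : (fderiv ℝ f (ι x)).range = ⊤)
    (hd : Module.finrank ℝ E = Module.finrank ℝ F + d) :
    HasLocalParam ι (EuclideanSpace ℝ (Fin d)) x := by
  set A : E →L[ℝ] F := fderiv ℝ f (ι x) with hA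
  -- a continuous linear complement of the derivative
  obtain ⟨P, hP⟩ : ∃ P : E →L[ℝ] EuclideanSpace ℝ (Fin d), ∃ e : E ≃L[ℝ] F × EuclideanSpace ℝ (Fin d),
      (e : E →L[ℝ] F × EuclideanSpace ℝ (Fin d)) = A.prod P := by
    obtain ⟨C, hC⟩ := Submodule.exists_isCompl A.ker
    have hk : Module.finrank ℝ A.ker = d := by
      have := LinearMap.finrank_range_add_finrank_ker (A : E →ₗ[ℝ] F)
      have h2 : Module.finrank ℝ (A : E →ₗ[ℝ] F).range = Module.finrank ℝ F := by
        rw [hx]; exact finrank_top ℝ F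
      rw [h2] at this
      change Module.finrank ℝ (A : E →ₗ[ℝ] F).ker = d
      omega
    let l : A.ker ≃ₗ[ℝ] EuclideanSpace ℝ (Fin d) :=
      LinearEquiv.ofFinrankEq _ _ (by rw [hk]; simp)
    let P0 : E →ₗ[ℝ] EuclideanSpace ℝ (Fin d) := l.toLinearMap ∘ₗ A.ker.projectionOnto C hC
    let P : E →L[ℝ] EuclideanSpace ℝ (Fin d) := LinearMap.toContinuousLinearMap P0
    have hPk : (P : E →ₗ[ℝ] EuclideanSpace ℝ (Fin d)).ker = C := by
      ext y
      simp [P, P0]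
    have hPr : (P : E →ₗ[ℝ] EuclideanSpace ℝ (Fin d)).range = ⊤ := by
      rw [LinearMap.range_eq_top]
      intro v
      refine ⟨(l.symm v : A.ker), ?_⟩
      simp [P, P0]
    have : CompleteSpace E := FiniteDimensional.complete ℝ E
    have : CompleteSpace F := FiniteDimensional.complete ℝ F
    refine ⟨P, ContinuousLinearMap.equivProdOfSurjectiveOfIsCompl A P hx hPr (by rw [hPk]; exact hC), ?_⟩
    ext y <;> simp
  obtain ⟨eq, heq⟩ := hP
  have : CompleteSpace E := FiniteDimensional.complete ℝ E
  let Φ : E → F × EuclideanSpace ℝ (Fin d) := fun y => (f y, P y)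
  have hΦ : ContDiff ℝ ∞ Φ := hf.prodMk P.contDiff
  have hfd : ∀ y, HasFDerivAt f (fderiv ℝ f y) y := fun y =>
    (hf.differentiable (by simp) y).hasFDerivAt
  have hΦd : ∀ y, HasFDerivAt Φ ((fderiv ℝ f y).prod P) y := fun y =>
    (hfd y).prodMk P.hasFDerivAt
  have hΦx : HasFDerivAt Φ (eq : E →L[ℝ] F × EuclideanSpace ℝ (Fin d)) (ι x) := by
    rw [heq]; exact hΦd _
  let e0 := hΦ.contDiffAt.toOpenPartialHomeomorph Φ hΦx (n := ∞) (by simp)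
  have he0x : ι x ∈ e0.source := hΦ.contDiffAt.mem_toOpenPartialHomeomorph_source hΦx (by simp)
  let O : Set E := (fun y => (fderiv ℝ f y).prod P) ⁻¹'
    Set.range (ContinuousLinearEquiv.toContinuousLinearMap :
      (E ≃L[ℝ] F × EuclideanSpace ℝ (Fin d)) → E →L[ℝ] F × EuclideanSpace ℝ (Fin d))
  have hO : IsOpen O := by
    refine (ContinuousLinearEquiv.isOpen (𝕜 := ℝ)).preimage ?_
    have h1 : Continuous (fun y => fderiv ℝ f y) := hf.continuous_fderiv (by simp)
    exact (ContinuousLinearMap.prodₗᵢ ℝ (E := E) (F := F) (G := EuclideanSpace ℝ (Fin d)) (𝕜 := ℝ)).continuous.comp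
      (h1.prodMk continuous_const)
  let e := e0.restrOpen O hO
  have hes : e.source = e0.source ∩ O := rfl
  have hex : ι x ∈ e.source := ⟨he0x, eq, by rw [heq]⟩
  have heΦ : ∀ y, e y = Φ y := fun y => rfl
  have hsymm : ContDiffOn ℝ ∞ e.symm e.target := by
    intro a ha
    have h1 : e.symm a ∈ e.source := e.map_target ha
    obtain ⟨g, hg⟩ := h1.2
    refine (e.contDiffAt_symm ha (f₀' := g) ?_ hΦ.contDiffAt).contDiffWithinAt
    rw [hg]
    exact hΦd _
  have hmem : ∀ w : EuclideanSpace ℝ (Fin d), (0, w) ∈ e.target → ∃ y, ι y = e.symm (0, w) := by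
    intro w hw
    have : f (e.symm (0, w)) = 0 := congrArg Prod.fst (e.right_inv hw)
    have h3 : e.symm (0, w) ∈ f ⁻¹' {0} := this
    rw [← hr] at h3
    exact h3
  classical
  have hzero : ∀ y, f (ι y) = 0 := fun y => by
    have : ι y ∈ f ⁻¹' {0} := hr ▸ Set.mem_range_self y
    exact this
  let s : EuclideanSpace ℝ (Fin d) → X := fun w =>
    if h : (0, w) ∈ e.target then (hmem w h).choose else x
  have hs : ∀ w, (0, w) ∈ e.target → ι (s w) = e.symm (0, w) := by
    intro w h
    simp only [s, dif_pos h]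
    exact (hmem w h).choose_spec
  refine ⟨e.source, {w | (0, w) ∈ e.target}, P, s, e.open_source,
    e.open_target.preimage (by fun_prop), hex, P.contDiff.contDiffOn, ?_, ?_, ?_⟩
  · refine ContDiffOn.congr (f := fun w => e.symm (0, w)) ?_ hs
    refine hsymm.comp (g := e.symm) (f := fun w : EuclideanSpace ℝ (Fin d) => ((0 : F), w)) ?_ (fun w hw => hw)
    fun_prop
  · intro y hy
    have h1 : e (ι y) = (0, P (ι y)) := by rw [heΦ]; simp [Φ, hzero]
    have h2 : ((0 : F), P (ι y)) ∈ e.target := h1 ▸ e.map_source hy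
    refine ⟨h2, hι ?_⟩
    rw [hs _ h2, ← h1, e.left_inv hy]
  · intro w hw
    rw [hs w hw]
    exact ⟨e.map_target hw, congrArg Prod.snd (e.right_inv hw)⟩

/-- The quotient of a submanifold by a free smooth action of a finite group has enough smooth
charts. -/
theorem exists_smoothChart [TopologicalSpace X] {G : Type*} [Group G] [Finite G] [MulAction G X] {ι : X → E}
    (hι : Topology.IsEmbedding ι)
    (hfree : ∀ (g : G) (x : X), g • x = x → g = 1)
    (hact : ∀ g : G, ∃ A : E → E, ContDiff ℝ ∞ A ∧ ∀ x, ι (g • x) = A (ι x)) (d : ℕ)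
    (hparam : ∀ x : X, HasLocalParam ι (EuclideanSpace ℝ (Fin d)) x)
    (n : MulAction.orbitRel.Quotient G X) :
    ∃ e ∈ smoothCharts ι (Quotient.mk (MulAction.orbitRel G X)) d, n ∈ e.source := by
  set π : X → MulAction.orbitRel.Quotient G X := Quotient.mk (MulAction.orbitRel G X) with hπdef
  have hcont : ∀ g : G, Continuous fun x : X => g • x := by
    intro g
    obtain ⟨A, hA, hAx⟩ := hact g
    rw [hι.continuous_iff]
    have : (ι ∘ fun x : X => g • x) = A ∘ ι := funext hAx
    rw [this]
    exact hA.continuous.comp hι.continuous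
  have : ContinuousConstSMul G X := ⟨hcont⟩
  have : T2Space X := hι.t2Space
  have hπo : IsOpenMap π := isOpenMap_quotient_mk'_mul
  have hπc : Continuous π := continuous_quotient_mk'
  have hπg : ∀ y y', π y = π y' ↔ ∃ g : G, g • y' = y := fun y y' => by
    rw [hπdef, Quotient.eq]; exact MulAction.orbitRel_apply
  obtain ⟨x, rfl⟩ := Quotient.exists_rep n
  change ∃ e ∈ smoothCharts ι π d, π x ∈ e.source
  -- a neighbourhood on which `π` is injective
  obtain ⟨O, hO, hxO, hinj⟩ : ∃ O : Set X, IsOpen O ∧ x ∈ O ∧ Set.InjOn π O := by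
    have h1 : ∀ g : G, ∃ O : Set X, IsOpen O ∧ x ∈ O ∧ (g = 1 ∨ ∀ y ∈ O, g • y ∉ O) := by
      intro g
      by_cases hg : g = 1
      · exact ⟨Set.univ, isOpen_univ, trivial, Or.inl hg⟩
      · have hne : x ≠ g • x := fun h => hg (hfree g x h.symm)
        obtain ⟨A, B, hA, hB, hxA, hxB, hAB⟩ := t2_separation hne
        refine ⟨A ∩ (fun y => g • y) ⁻¹' B, hA.inter (hB.preimage (hcont g)), ⟨hxA, hxB⟩,
          Or.inr fun y hy hgy => ?_⟩
        exact Set.disjoint_left.1 hAB hgy.1 hy.2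
    choose O hO hxO hOg using h1
    refine ⟨⋂ g, O g, isOpen_iInter_of_finite hO, Set.mem_iInter.2 hxO, fun y hy y' hy' h => ?_⟩
    obtain ⟨g, hg⟩ := (hπg y y').1 h
    rcases hOg g with h1 | h1
    · rw [← hg, h1, one_smul]
    · exact absurd (hg ▸ Set.mem_iInter.1 hy g : g • y' ∈ O g) (h1 y' (Set.mem_iInter.1 hy' g))
  obtain ⟨U0, hU0, hU0O⟩ := hι.isOpen_iff.1 hO
  obtain ⟨U1, W1, ψ, s, hU1, hW1, hxU1, hψ, hs, h1, h2⟩ := hparam x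
  let U := U1 ∩ U0
  let W := W1 ∩ (ι ∘ s) ⁻¹' U0
  have hU : IsOpen U := hU1.inter hU0
  have hW : IsOpen W := hs.continuousOn.isOpen_inter_preimage hW1 hU0
  have hmemO : ∀ y, ι y ∈ U → y ∈ O := fun y hy => hU0O ▸ hy.2
  let h : OpenPartialHomeomorph X (EuclideanSpace ℝ (Fin d)) :=
    { toFun := ψ ∘ ι
      invFun := s
      source := ι ⁻¹' U
      target := W
      map_source' := fun y hy => ⟨(h1 y hy.1).1, by
        change ι (s (ψ (ι y))) ∈ U0
        rw [(h1 y hy.1).2]; exact hy.2⟩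
      map_target' := fun w hw => ⟨(h2 w hw.1).1, hw.2⟩
      left_inv' := fun y hy => (h1 y hy.1).2
      right_inv' := fun w hw => (h2 w hw.1).2
      open_source := hU.preimage hι.continuous
      open_target := hW
      continuousOn_toFun :=
        (hψ.continuousOn.mono Set.inter_subset_left).comp hι.continuous.continuousOn fun y hy => hy
      continuousOn_invFun := by
        rw [hι.continuousOn_iff]
        exact hs.continuousOn.mono Set.inter_subset_left }
  have : Nonempty X := ⟨x⟩
  let p : OpenPartialHomeomorph X (MulAction.orbitRel.Quotient G X) :=
    OpenPartialHomeomorph.ofContinuousOpen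
      ((hinj.mono fun y hy => hmemO y hy : Set.InjOn π (ι ⁻¹' U)).toPartialEquiv)
      hπc.continuousOn hπo (hU.preimage hι.continuous)
  have hpc : ∀ y, p y = π y := fun y => rfl
  have hps : p.source = ι ⁻¹' U := rfl
  have hpt : p.target = π '' (ι ⁻¹' U) := rfl
  let e := p.symm.trans' h rfl
  have hes : e.source = π '' (ι ⁻¹' U) := rfl
  have het : e.target = W := rfl
  have hee : ∀ y, ι y ∈ U → e (π y) = ψ (ι y) := by
    intro y hy
    change ψ (ι (p.symm (π y))) = _
    rw [← hpc, p.left_inv hy]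
  have hesymm : ∀ w, e.symm w = π (s w) := fun w => rfl
  have hxU : ι x ∈ U := ⟨hxU1, by have : x ∈ ι ⁻¹' U0 := hU0O ▸ hxO; exact this⟩
  refine ⟨e, ⟨?_, ?_⟩, ⟨x, hxU, rfl⟩⟩
  · rintro y ⟨y0, hy0, hy⟩
    obtain ⟨g, hg⟩ := (hπg y0 y).1 hy
    obtain ⟨A, hA, hAx⟩ := hact g
    refine ⟨A ⁻¹' U, ψ ∘ A, hU.preimage hA.continuous, ?_, ?_, ?_⟩
    · change A (ι y) ∈ U
      rw [← hAx, hg]; exact hy0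
    · exact (hψ.mono Set.inter_subset_left).comp hA.contDiffOn fun z hz => hz
    · intro z hz _
      have hz : A (ι z) ∈ U := hz
      rw [← hAx] at hz
      have h3 : π (g • z) = π z := (hπg _ _).2 ⟨g, rfl⟩
      rw [← h3, hee _ hz, Function.comp_apply, hAx]
  · intro v hv
    exact ⟨W, s, hW, hv, subset_rfl, hs.mono Set.inter_subset_left, fun w _ => rfl⟩

end SmoothStructure

/-- Data `(Γ, c)` of a nonempty nondegenerate intersection of `d = m - n` quadrics in `ℝ^m` for which
the torus `T_Γ` is defined. -/
structure QuadricData (m d : ℕ) where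
  /-- the vectors `γ₁, …, γₘ ∈ ℝ^d` -/
  γ : Fin m → Fin d → ℝ
  /-- the right-hand side `c ∈ ℝ^d` -/
  c : Fin d → ℝ
  /-- `c` lies in the cone generated by `γ₁, …, γₘ` -/
  mem_cone : c ∈ PointedCone.hull ℝ (Set.range γ)
  /-- `c` lies in no cone generated by fewer than `d` of the `γₖ` -/
  le_card : ∀ I : Finset (Fin m), c ∈ PointedCone.hull ℝ (γ '' I) → d ≤ I.card
  /-- the `γₖ` generate a lattice (a discrete subgroup of `ℝ^d`) -/
  discrete : DiscreteTopology (Submodule.span ℤ (Set.range γ))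

namespace QuadricData

variable {m d : ℕ} (Q : QuadricData m d)

/-- The real intersection of quadrics `R_Γ = {u ∈ ℝ^m : ∑ₖ γₖ uₖ² = c}`. -/
def R : Set (Fin m → ℝ) := {u | ∑ k, u k ^ 2 • Q.γ k = Q.c}

/-- The lattice `L` generated by the vectors `γₖ`. -/
def L : Submodule ℤ (Fin d → ℝ) := Submodule.span ℤ (Set.range Q.γ)

/-- The dual lattice `L* = {φ : ⟨l, φ⟩ ∈ ℤ for all l ∈ L}`. -/
def dualL : AddSubgroup (Fin d → ℝ) where
  carrier := {φ | ∀ l ∈ Q.L, ∃ n : ℤ, l ⬝ᵥ φ = n}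
  zero_mem' := fun l _ => ⟨0, by simp⟩
  add_mem' := fun {a b} ha hb l hl => by
    obtain ⟨n, hn⟩ := ha l hl
    obtain ⟨n', hn'⟩ := hb l hl
    exact ⟨n + n', by rw [dotProduct_add, hn, hn']; push_cast; rfl⟩
  neg_mem' := fun {a} ha l hl => by
    obtain ⟨n, hn⟩ := ha l hl
    exact ⟨-n, by rw [dotProduct_neg, hn]; push_cast; rfl⟩

/-- The point `(e^{2πi⟨γ₁,φ⟩}, …, e^{2πi⟨γₘ,φ⟩})` of the torus `𝕋^m ⊂ ℂ^m`. -/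
def torusPoint (φ : Fin d → ℝ) : Fin m → ℂ := fun k =>
  Complex.exp (2 * Real.pi * Complex.I * ((Q.γ k ⬝ᵥ φ : ℝ) : ℂ))

theorem torusPoint_add (φ ψ : Fin d → ℝ) :
    Q.torusPoint (φ + ψ) = Q.torusPoint φ * Q.torusPoint ψ := by
  ext k
  simp only [torusPoint, Pi.mul_apply, ← Complex.exp_add, dotProduct_add]
  push_cast
  ring_nf

/-- The torus `T_Γ = {(e^{2πi⟨γ₁,φ⟩}, …, e^{2πi⟨γₘ,φ⟩}) : φ ∈ ℝ^d} ⊂ 𝕋^m`. -/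
def T : Set (Fin m → ℂ) := Set.range Q.torusPoint

/-- The finite group `D_Γ = ½L*/L*`, embedded in `{±1}^m ⊂ 𝕋^m` by
`φ ↦ (e^{2πi⟨γ₁,φ⟩}, …, e^{2πi⟨γₘ,φ⟩})`, `φ ∈ ½L*`. -/
def D : Subgroup (Fin m → ℤˣ) where
  carrier := {ε | ∃ ψ ∈ Q.dualL, ∀ k, ((ε k : ℤ) : ℂ) = Q.torusPoint ((1 / 2 : ℝ) • ψ) k}
  one_mem' := ⟨0, Q.dualL.zero_mem, fun k => by simp [torusPoint]⟩
  mul_mem' := by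
    rintro a b ⟨ψ, hψ, h⟩ ⟨ψ', hψ', h'⟩
    refine ⟨ψ + ψ', Q.dualL.add_mem hψ hψ', fun k => ?_⟩
    rw [smul_add, torusPoint_add, Pi.mul_apply, Pi.mul_apply, ← h, ← h']
    push_cast
    rfl
  inv_mem' := by
    rintro a ⟨ψ, hψ, h⟩
    refine ⟨ψ, hψ, fun k => ?_⟩
    rw [← h, Pi.inv_apply, Int.units_inv_eq_self]

/-- `D_Γ` acts on `R_Γ` by coordinatewise sign changes. -/
instance : MulAction Q.D Q.R where
  smul ε u := ⟨fun k => ((ε.1 k : ℤ) : ℝ) * u.1 k, by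
    have h : ∀ k, (((ε.1 k : ℤ) : ℝ) * u.1 k) ^ 2 = u.1 k ^ 2 := fun k => by
      rcases Int.units_eq_one_or (ε.1 k) with h | h <;> simp [h]
    have := u.2
    simp only [R, Set.mem_ofPred_eq, h] at this ⊢
    exact this⟩
  one_smul u := Subtype.ext (funext fun k => by
    change (((1 : ℤˣ) : ℤ) : ℝ) * u.1 k = u.1 k
    simp)
  mul_smul ε ε' u := Subtype.ext (funext fun k => by
    change (((ε.1 k * ε'.1 k : ℤˣ) : ℤ) : ℝ) * u.1 k = (ε.1 k : ℤ) * ((ε'.1 k : ℤ) * u.1 k)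
    push_cast; ring)

/-- `D_Γ` acts on `T_Γ` by multiplication. -/
instance : MulAction Q.D Q.T where
  smul ε t := ⟨fun k => ((ε.1 k : ℤ) : ℂ) * t.1 k, by
    obtain ⟨ψ, _, h⟩ := ε.2
    obtain ⟨φ, hφ⟩ := t.2
    refine ⟨(1 / 2 : ℝ) • ψ + φ, funext fun k => ?_⟩
    rw [torusPoint_add, Pi.mul_apply, ← h, hφ]⟩
  one_smul t := Subtype.ext (funext fun k => by
    change (((1 : ℤˣ) : ℤ) : ℂ) * t.1 k = t.1 k
    simp)
  mul_smul ε ε' t := Subtype.ext (funext fun k => by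
    change (((ε.1 k * ε'.1 k : ℤˣ) : ℤ) : ℂ) * t.1 k = (ε.1 k : ℤ) * ((ε'.1 k : ℤ) * t.1 k)
    push_cast; ring)

/-- `N_Γ = R_Γ ×_{D_Γ} T_Γ`, the quotient of `R_Γ × T_Γ` by the diagonal action of `D_Γ`, with the
quotient topology. -/
def N : Type := MulAction.orbitRel.Quotient Q.D (Q.R × Q.T)

instance : TopologicalSpace Q.N := inferInstanceAs (TopologicalSpace (Quotient _))

/-- The quotient map `R_Γ × T_Γ → N_Γ`. -/
def proj (x : Q.R × Q.T) : Q.N := Quotient.mk (MulAction.orbitRel Q.D (Q.R × Q.T)) x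

/-- The map `i_Γ : N_Γ → ℂ^m` induced by `(u, t) ↦ (u₁t₁, …, uₘtₘ)`. -/
def immersion : Q.N → (Fin m → ℂ) :=
  Quotient.lift (fun x : Q.R × Q.T => fun k => (x.1.1 k : ℂ) * x.2.1 k) (by
    rintro x y h
    obtain ⟨ε, rfl⟩ := MulAction.orbitRel_apply.1 h
    funext k
    change ((((ε.1 k : ℤ) : ℝ) * y.1.1 k : ℝ) : ℂ) * (((ε.1 k : ℤ) : ℂ) * y.2.1 k) = _
    rcases Int.units_eq_one_or (ε.1 k) with h | h <;> simp [h])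

/-- The inclusion of `R_Γ × T_Γ` in the ambient space `ℝ^m × ℂ^m`. -/
def incl (x : Q.R × Q.T) : (Fin m → ℝ) × (Fin m → ℂ) := (x.1.1, x.2.1)

theorem isEmbedding_incl : Topology.IsEmbedding Q.incl :=
  Topology.IsEmbedding.subtypeVal.prodMap Topology.IsEmbedding.subtypeVal

/-- At every point of `R_Γ` the vectors `γₖ` with `uₖ ≠ 0` span `ℝ^d`; so `R_Γ` is regular. -/
theorem span_eq_top (u : Q.R) : Submodule.span ℝ (Q.γ '' {k | u.1 k ≠ 0}) = ⊤ := by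
  classical
  -- nonnegative representations of `c` supported where `u` does not vanish
  let S : Set ℕ := {n | ∃ y : Fin m → ℝ, (∀ k, 0 ≤ y k) ∧ (∀ k, y k ≠ 0 → u.1 k ≠ 0) ∧
    ∑ k, y k • Q.γ k = Q.c ∧ (Finset.univ.filter fun k => y k ≠ 0).card = n}
  have hS : S.Nonempty := ⟨_, fun k => u.1 k ^ 2, fun k => sq_nonneg _, fun k h => by
    intro h0; simp [h0] at h, u.2, rfl⟩
  obtain ⟨y, hy0, hyu, hyc, hyn⟩ := Nat.sInf_mem hS
  set I : Finset (Fin m) := Finset.univ.filter fun k => y k ≠ 0 with hI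
  have hsum : ∀ g : Fin m → ℝ, (∀ k ∉ I, g k = 0) → ∑ k ∈ I, g k • Q.γ k = ∑ k, g k • Q.γ k := by
    intro g hg
    exact Finset.sum_subset (Finset.subset_univ _) fun k _ hk => by rw [hg k hk, zero_smul]
  have hle : d ≤ I.card := by
    refine Q.le_card I ?_
    rw [← hyc, ← hsum y (fun k hk => by simpa [hI] using hk)]
    refine Submodule.sum_mem _ fun k hk => ?_
    exact Submodule.smul_mem (PointedCone.hull ℝ (Q.γ '' I)) ⟨y k, hy0 k⟩
      (Submodule.subset_span ⟨k, hk, rfl⟩)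
  have hli : LinearIndependent ℝ (fun k : I => Q.γ k) := by
    rw [Fintype.linearIndependent_iff]
    by_contra! hcon
    obtain ⟨g0, hg0, i0, hi0⟩ := hcon
    obtain ⟨g, hgI, hgs, i, hi⟩ : ∃ g : Fin m → ℝ, (∀ k ∉ I, g k = 0) ∧
        ∑ k, g k • Q.γ k = 0 ∧ ∃ i, 0 < g i := by
      let g1 : Fin m → ℝ := fun k => if h : k ∈ I then g0 ⟨k, h⟩ else 0
      have h1 : ∀ k ∉ I, g1 k = 0 := fun k hk => dif_neg hk
      have h2 : ∑ k, g1 k • Q.γ k = 0 := by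
        rw [← hsum g1 h1, ← Finset.sum_coe_sort, ← hg0]
        refine Finset.sum_congr rfl fun k _ => ?_
        simp [g1]
      have h3 : g1 i0 = g0 i0 := by simp [g1]
      rcases lt_or_gt_of_ne hi0 with h | h
      · refine ⟨-g1, fun k hk => by simp [h1 k hk], by simp [h2], i0, ?_⟩
        simp only [Pi.neg_apply, h3]; linarith
      · exact ⟨g1, h1, h2, i0, by rw [h3]; exact h⟩
    obtain ⟨j, hj, hjmin⟩ := Finset.exists_min_image (Finset.univ.filter fun k => 0 < g k)
      (fun k => y k / g k) ⟨i, by simpa using hi⟩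
    have hgj : 0 < g j := by simpa using hj
    set t := y j / g j with ht
    have ht0 : 0 ≤ t := div_nonneg (hy0 j) hgj.le
    let y' : Fin m → ℝ := fun k => y k - t * g k
    have hy'j : y' j = 0 := by simp only [y', ht]; field_simp; ring
    have hjI : j ∈ I := by by_contra h; rw [hgI j h] at hgj; exact lt_irrefl _ hgj
    have hsub : ∀ k, y' k ≠ 0 → k ∈ I := by
      intro k hk
      by_contra h
      have h0 : y k = 0 := by simpa [hI] using h
      exact hk (by simp [y', h0, hgI k h])
    have hlt : (Finset.univ.filter fun k => y' k ≠ 0).card < I.card := by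
      refine Finset.card_lt_card ⟨fun k hk => hsub k (by simpa using hk), fun h => ?_⟩
      have := h hjI
      simp [hy'j] at this
    have : sInf S ≤ (Finset.univ.filter fun k => y' k ≠ 0).card := by
      refine Nat.sInf_le ⟨y', fun k => ?_, fun k hk => ?_, ?_, rfl⟩
      · rcases lt_or_ge 0 (g k) with h | h
        · have := hjmin k (by simpa using h)
          rw [le_div_iff₀ h] at this
          simp only [y']; linarith
        · have := mul_nonneg ht0 (neg_nonneg.2 h)
          simp only [y']; nlinarith [hy0 k]
      · exact hyu k (by simpa [hI] using hsub k hk)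
      · simp only [y', sub_smul, Finset.sum_sub_distrib, mul_smul, ← Finset.smul_sum, hgs, hyc]
        simp
    omega
  have hcard : I.card = d := by
    have := hli.fintype_card_le_finrank
    simp at this
    omega
  have htop : Submodule.span ℝ (Set.range fun k : I => Q.γ k) = ⊤ := by
    apply hli.span_eq_top_of_card_eq_finrank'
    simp [hcard]
  rw [eq_top_iff, ← htop]
  refine Submodule.span_mono ?_
  rintro _ ⟨k, rfl⟩
  exact ⟨k, hyu k (Finset.mem_filter.1 k.2).2, rfl⟩

theorem le_dim (Q : QuadricData m d) : d ≤ m := by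
  simpa using Q.le_card Finset.univ (by simpa using Q.mem_cone)

theorem hasLocalParam_R (u : Q.R) :
    HasLocalParam (Subtype.val : Q.R → Fin m → ℝ) (EuclideanSpace ℝ (Fin (m - d))) u := by
  let f : (Fin m → ℝ) → (Fin d → ℝ) := fun u => ∑ k, u k ^ 2 • Q.γ k - Q.c
  have hf : ContDiff ℝ ∞ f := by fun_prop
  refine hasLocalParam_levelSet (m - d) Subtype.val_injective (f := f) hf ?_ u ?_ ?_
  · ext v
    simp [f, R, sub_eq_zero]
  · have hd : HasFDerivAt f (∑ k, ((2 * u.1 k) • (ContinuousLinearMap.proj (R := ℝ) (φ := fun _ : Fin m => ℝ) k)).smulRight (Q.γ k)) u.1 := by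
      refine HasFDerivAt.sub_const _ (HasFDerivAt.fun_sum fun k _ => ?_)
      refine HasFDerivAt.smul_const ?_ _
      have := (ContinuousLinearMap.proj (R := ℝ) (φ := fun _ : Fin m => ℝ) k).hasFDerivAt (x := u.1)
      simpa using this.pow 2
    rw [hd.fderiv, eq_top_iff, ← Q.span_eq_top u, Submodule.span_le]
    rintro _ ⟨k, hk, rfl⟩
    have hk : u.1 k ≠ 0 := hk
    refine ⟨Pi.single k (1 / (2 * u.1 k)), ?_⟩
    have h1 : 2 * u.1 k * ((u.1 k)⁻¹ * 2⁻¹) = 1 := by field_simp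
    simp [Pi.single_apply, h1]
  · have := Q.le_dim
    simp
    omega

/-- `z ^ n` for integer `n`, with `conj z` in place of `z⁻¹`. -/
def unitPow (n : ℤ) (z : ℂ) : ℂ :=
  if 0 ≤ n then z ^ n.toNat else (starRingEnd ℂ z) ^ (-n).toNat

theorem unitPow_exp (n : ℤ) (r : ℝ) :
    unitPow n (Complex.exp (2 * Real.pi * Complex.I * (r : ℂ))) =
      Complex.exp (2 * Real.pi * Complex.I * ((n * r : ℝ) : ℂ)) := by
  unfold unitPow
  split_ifs with h
  · obtain ⟨k, rfl⟩ := Int.eq_ofNat_of_zero_le h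
    rw [← Complex.exp_nat_mul]
    congr 1
    simp
    ring
  · obtain ⟨k, hk⟩ := Int.eq_ofNat_of_zero_le (a := -n) (by omega)
    obtain rfl : n = -(k : ℤ) := by omega
    rw [← Complex.exp_conj, ← Complex.exp_nat_mul]
    congr 1
    simp only [map_mul, Complex.conj_I, Complex.conj_ofReal, map_ofNat, neg_neg, Int.toNat_natCast]
    push_cast
    ring

theorem contDiff_unitPow (n : ℤ) : ContDiff ℝ ∞ (unitPow n) := by
  unfold unitPow
  split_ifs with h
  · fun_prop
  · exact (Complex.conjCLE.contDiff).pow _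

theorem exp_eq_iff (r r' : ℝ) :
    Complex.exp (2 * Real.pi * Complex.I * (r : ℂ)) =
      Complex.exp (2 * Real.pi * Complex.I * (r' : ℂ)) ↔ ∃ n : ℤ, r = r' + n := by
  rw [Complex.exp_eq_exp_iff_exists_int]
  refine exists_congr fun n => ?_
  have h : (2 * Real.pi * Complex.I : ℂ) ≠ 0 := Complex.two_pi_I_ne_zero
  constructor
  · intro h1
    have : (2 * Real.pi * Complex.I : ℂ) * r = (2 * Real.pi * Complex.I) * ((r' + n : ℝ) : ℂ) := by
      rw [h1]; push_cast; ring
    exact_mod_cast mul_left_cancel₀ h this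
  · rintro rfl
    push_cast; ring

theorem log_exp_im {r : ℝ} (h1 : -(1 / 2) < r) (h2 : r < 1 / 2) :
    Complex.exp (2 * Real.pi * Complex.I * (r : ℂ)) ∈ Complex.slitPlane ∧
    (Complex.log (Complex.exp (2 * Real.pi * Complex.I * (r : ℂ)))).im / (2 * Real.pi) = r := by
  have him : (2 * Real.pi * Complex.I * (r : ℂ)).im = 2 * Real.pi * r := by simp
  have hpi := Real.pi_pos
  have hlog : Complex.log (Complex.exp (2 * Real.pi * Complex.I * (r : ℂ))) =
      2 * Real.pi * Complex.I * (r : ℂ) :=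
    Complex.log_exp (by rw [him]; nlinarith) (by rw [him]; nlinarith)
  refine ⟨?_, by rw [hlog, him]; field_simp⟩
  rw [Complex.mem_slitPlane_iff_arg, ← Complex.log_im, hlog, him]
  exact ⟨by nlinarith, Complex.exp_ne_zero _⟩

theorem exp_log_im (r : ℝ) :
    Complex.exp (2 * Real.pi * Complex.I *
      (((Complex.log (Complex.exp (2 * Real.pi * Complex.I * (r : ℂ)))).im / (2 * Real.pi) : ℝ) : ℂ))
      = Complex.exp (2 * Real.pi * Complex.I * (r : ℂ)) := by
  set z := Complex.exp (2 * Real.pi * Complex.I * (r : ℂ)) with hz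
  have hn : ‖z‖ = 1 := by rw [hz, Complex.norm_exp]; simp
  have h := Complex.norm_mul_exp_arg_mul_I z
  rw [hn, Complex.ofReal_one, one_mul] at h
  rw [Complex.log_im]
  conv_rhs => rw [← h]
  congr 1
  have := Real.pi_ne_zero
  push_cast
  field_simp

theorem hasLocalParam_T (u : Q.R) (t : Q.T) :
    HasLocalParam (Subtype.val : Q.T → Fin m → ℂ) (EuclideanSpace ℝ (Fin d)) t := by
  classical
  have : DiscreteTopology Q.L := Q.discrete
  have hz : IsZLattice ℝ Q.L := ⟨by
    rw [eq_top_iff, ← Q.span_eq_top u]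
    refine Submodule.span_mono ?_
    rintro _ ⟨k, -, rfl⟩
    exact Submodule.subset_span ⟨k, rfl⟩⟩
  have : Module.Free ℤ Q.L := ZLattice.module_free ℝ Q.L
  have : Module.Finite ℤ Q.L := ZLattice.module_finite ℝ Q.L
  let J := Module.Free.ChooseBasisIndex ℤ Q.L
  let b : Module.Basis J ℤ Q.L := Module.Free.chooseBasis ℤ Q.L
  let bR : Module.Basis J ℝ (Fin d → ℝ) := b.ofZLatticeBasis ℝ Q.L
  have hJ : Fintype.card J = d := by
    have := Module.finrank_eq_card_basis bR
    simpa using this.symm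
  have hγL : ∀ k, Q.γ k ∈ Q.L := fun k => Submodule.subset_span ⟨k, rfl⟩
  let a : Fin m → J → ℤ := fun k j => b.repr ⟨Q.γ k, hγL k⟩ j
  have ha : ∀ k, Q.γ k = ∑ j, (a k j : ℝ) • (b j : Fin d → ℝ) := by
    intro k
    have := congrArg (Subtype.val) (b.sum_repr ⟨Q.γ k, hγL k⟩)
    simp only [Submodule.coe_sum, Submodule.coe_smul] at this
    rw [← this]
    exact Finset.sum_congr rfl fun j _ => (Int.cast_smul_eq_zsmul ℝ _ _).symm
  have hn : ∀ j, ∃ n : Fin m → ℤ, ∑ k, n k • Q.γ k = (b j : Fin d → ℝ) := fun j =>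
    (Submodule.mem_span_range_iff_exists_fun ℤ).1 (b j).2
  choose n hn using hn
  have hbdot : ∀ j φ, (b j : Fin d → ℝ) ⬝ᵥ φ = ∑ k, (n j k : ℝ) * (Q.γ k ⬝ᵥ φ) := by
    intro j φ
    rw [← hn j, sum_dotProduct]
    refine Finset.sum_congr rfl fun k _ => ?_
    rw [← Int.cast_smul_eq_zsmul ℝ, smul_dotProduct, smul_eq_mul]
  have hγdot : ∀ k φ, Q.γ k ⬝ᵥ φ = ∑ j, (a k j : ℝ) * ((b j : Fin d → ℝ) ⬝ᵥ φ) := by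
    intro k φ
    conv_lhs => rw [ha k, sum_dotProduct]
    simp only [smul_dotProduct, smul_eq_mul]
  have hsurj : ∀ x : J → ℝ, ∃ φ : Fin d → ℝ, ∀ j, (b j : Fin d → ℝ) ⬝ᵥ φ = x j := by
    intro x
    let f := bR.constr ℝ x
    refine ⟨fun i => f (Pi.single i 1), fun j => ?_⟩
    have h1 : f (b j : Fin d → ℝ) = x j := by
      have := bR.constr_basis ℝ x j
      rwa [Module.Basis.ofZLatticeBasis_apply] at this
    rw [← h1, LinearMap.pi_apply_eq_sum_univ f]
    simp only [dotProduct, smul_eq_mul]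
    refine Finset.sum_congr rfl fun i _ => ?_
    congr 2
    ext i'
    simp [Pi.single_apply, eq_comm]
  obtain ⟨φ0, hφ0⟩ := t.2
  -- the characters given by the lattice basis, as smooth functions on the ambient space
  let w : J → (Fin m → ℂ) → ℂ := fun j z =>
    (∏ k, unitPow (n j k) (z k)) *
      Complex.exp (2 * Real.pi * Complex.I * ((-((b j : Fin d → ℝ) ⬝ᵥ φ0) : ℝ) : ℂ))
  have hw : ∀ j, ContDiff ℝ ∞ (w j) := fun j => by
    refine ContDiff.mul (contDiff_prod fun k _ => ?_) contDiff_const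
    exact (contDiff_unitPow _).comp (contDiff_apply ℝ ℂ k)
  have hwexp : ∀ j φ, w j (Q.torusPoint φ) = Complex.exp (2 * Real.pi * Complex.I *
      (((b j : Fin d → ℝ) ⬝ᵥ φ - (b j : Fin d → ℝ) ⬝ᵥ φ0 : ℝ) : ℂ)) := by
    intro j φ
    simp only [w, torusPoint, unitPow_exp, ← Complex.exp_sum, ← Complex.exp_add]
    congr 1
    rw [← Finset.mul_sum, ← mul_add, ← Complex.ofReal_sum, ← hbdot, ← Complex.ofReal_add]
    rfl
  let s0 : (J → ℝ) → (Fin m → ℂ) := fun x k =>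
    Complex.exp (2 * Real.pi * Complex.I * ((∑ j, (a k j : ℝ) * x j : ℝ) : ℂ))
  have hs0 : ∀ x φ, (∀ j, (b j : Fin d → ℝ) ⬝ᵥ φ = x j) → s0 x = Q.torusPoint φ := by
    intro x φ h
    funext k
    simp only [s0, torusPoint, hγdot k φ, h]
  let s : (J → ℝ) → Q.T := fun x =>
    ⟨s0 x, (hsurj x).choose, (hs0 x _ (hsurj x).choose_spec).symm⟩
  let ψ : (Fin m → ℂ) → (J → ℝ) := fun z j =>
    (b j : Fin d → ℝ) ⬝ᵥ φ0 + (Complex.log (w j z)).im / (2 * Real.pi)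
  have key : HasLocalParam (Subtype.val : Q.T → Fin m → ℂ) (J → ℝ) t := by
    refine ⟨{z | ∀ j, w j z ∈ Complex.slitPlane},
      {x | ∀ j, |x j - (b j : Fin d → ℝ) ⬝ᵥ φ0| < 1 / 2}, ψ, s, ?_, ?_, ?_, ?_, ?_, ?_, ?_⟩
    · simp only [Set.ofPred_forall]
      exact isOpen_iInter_of_finite fun j =>
        Complex.isOpen_slitPlane.preimage (hw j).continuous
    · simp only [Set.ofPred_forall]
      exact isOpen_iInter_of_finite fun j => isOpen_lt (by fun_prop) continuous_const
    · intro j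
      rw [← hφ0, hwexp, sub_self]
      simp
    · refine contDiffOn_pi.2 fun j => ?_
      refine contDiffOn_const.add (ContDiffOn.div_const ?_ _)
      intro z hz
      refine ContDiffAt.contDiffWithinAt ?_
      have h1 : ContDiffAt ℝ ∞ (fun z => Complex.log (w j z)) z :=
        ((Complex.contDiffAt_log (n := ∞) (hz j)).restrict_scalars ℝ).comp z (hw j).contDiffAt
      exact Complex.imCLM.contDiff.contDiffAt.comp z h1
    · refine contDiffOn_pi.2 fun k => ContDiff.contDiffOn ?_
      have h1 : ContDiff ℝ ∞ fun x : J → ℝ => ((∑ j, (a k j : ℝ) * x j : ℝ) : ℂ) :=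
        Complex.ofRealCLM.contDiff.comp
          (ContDiff.sum fun j _ => contDiff_const.mul (contDiff_apply ℝ ℝ j))
      exact (contDiff_const.mul h1).cexp
    · rintro ⟨_, φ, rfl⟩ hy
      have hy : ∀ j, w j (Q.torusPoint φ) ∈ Complex.slitPlane := hy
      refine ⟨fun j => ?_, Subtype.ext ?_⟩
      · simp only [ψ, add_sub_cancel_left]
        have h1 := (Complex.mem_slitPlane_iff_arg.1 (hy j)).1
        rw [← Complex.log_im] at h1
        have h2 := Complex.neg_pi_lt_log_im (w j (Q.torusPoint φ))
        have h3 := lt_of_le_of_ne (Complex.log_im_le_pi (w j (Q.torusPoint φ))) h1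
        have hpi := Real.pi_pos
        rw [abs_lt, lt_div_iff₀ (by positivity), div_lt_iff₀ (by positivity)]
        constructor <;> linarith
      · have h1 : ∀ j, ∃ N : ℤ, ψ (Q.torusPoint φ) j = (b j : Fin d → ℝ) ⬝ᵥ φ + N := by
          intro j
          rw [← exp_eq_iff]
          have h2 := exp_log_im ((b j : Fin d → ℝ) ⬝ᵥ φ - (b j : Fin d → ℝ) ⬝ᵥ φ0)
          rw [← hwexp] at h2
          obtain ⟨N, hN⟩ := (exp_eq_iff _ _).1 (h2.trans (hwexp j φ))
          rw [exp_eq_iff]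
          exact ⟨N, by simp only [ψ]; linarith⟩
        choose N hN using h1
        funext k
        change s0 (ψ (Q.torusPoint φ)) k = Q.torusPoint φ k
        simp only [s0, torusPoint]
        rw [exp_eq_iff]
        refine ⟨∑ j, a k j * N j, ?_⟩
        rw [hγdot k φ]
        push_cast
        rw [← Finset.sum_add_distrib]
        refine Finset.sum_congr rfl fun j _ => ?_
        rw [hN j]; ring
    · intro x hx
      obtain ⟨φ, hφ⟩ := hsurj x
      have h0 : (s x).1 = Q.torusPoint φ := hs0 x φ hφ
      rw [h0]
      have h1 : ∀ j, _ := fun j => log_exp_im (r := x j - (b j : Fin d → ℝ) ⬝ᵥ φ0)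
        (abs_lt.1 (hx j)).1 (abs_lt.1 (hx j)).2
      refine ⟨fun j => ?_, funext fun j => ?_⟩
      · rw [hwexp, hφ]; exact (h1 j).1
      · simp only [ψ]
        rw [hwexp, hφ, (h1 j).2]
        ring
  refine key.congr (ContinuousLinearEquiv.ofFinrankEq ?_)
  simp [hJ]

theorem exists_chart (x : Q.N) :
    ∃ e ∈ smoothCharts Q.incl Q.proj m, x ∈ e.source := by
  refine exists_smoothChart Q.isEmbedding_incl ?_ ?_ m ?_ x
  · intro ε x h
    have h2 : ε • x.2 = x.2 := congrArg Prod.snd h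
    refine Subtype.ext (funext fun k => ?_)
    have h3 : ((ε.1 k : ℤ) : ℂ) * x.2.1 k = x.2.1 k := congrFun (congrArg Subtype.val h2) k
    have h4 : x.2.1 k ≠ 0 := by
      obtain ⟨φ, hφ⟩ := x.2.2
      rw [← hφ]
      exact Complex.exp_ne_zero _
    have h5 : ((ε.1 k : ℤ) : ℂ) = 1 := mul_right_cancel₀ h4 (by rw [h3, one_mul])
    have h6 : (ε.1 k : ℤ) = 1 := by exact_mod_cast h5
    exact Units.ext h6
  · intro ε
    refine ⟨fun z => (fun k => ((ε.1 k : ℤ) : ℝ) * z.1 k, fun k => ((ε.1 k : ℤ) : ℂ) * z.2 k),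
      ?_, fun x => rfl⟩
    fun_prop
  · rintro ⟨u, t⟩
    refine ((Q.hasLocalParam_R u).prodMap (Q.hasLocalParam_T u t)).congr
      (ContinuousLinearEquiv.ofFinrankEq ?_)
    have := Q.le_dim
    simp
    omega

/-- The `m`-dimensional smooth manifold `N_Γ`: the quotient map from the submanifold `R_Γ × T_Γ` of
`ℝ^m × ℂ^m` is a local diffeomorphism. -/
instance : ChartedSpace (EuclideanSpace ℝ (Fin m)) Q.N :=
  smoothQuotientChartedSpace Q.incl Q.proj m Q.exists_chart

instance : IsManifold 𝓘(ℝ, EuclideanSpace ℝ (Fin m)) ∞ Q.N :=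
  smoothQuotient_isManifold Q.incl Q.proj m Q.exists_chart

end QuadricData

/-- The product `S^{p-1} × S^{q-1} × S¹ × S¹`. The parameter `k` only determines the group action
below. -/
def ModelCover (_k p q : ℕ) : Type :=
  Metric.sphere (0 : EuclideanSpace ℝ (Fin p)) 1 × Metric.sphere (0 : EuclideanSpace ℝ (Fin q)) 1 ×
    Circle × Circle

namespace ModelCover

variable (k p q : ℕ)

instance : TopologicalSpace (ModelCover k p q) :=
  inferInstanceAs (TopologicalSpace (Metric.sphere (0 : EuclideanSpace ℝ (Fin p)) 1 ×
    Metric.sphere (0 : EuclideanSpace ℝ (Fin q)) 1 × Circle × Circle))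

/-- The map `(x₁, …, x_p) ↦ (σ₁x₁, …, σ_p x_p)` of the unit sphere, for signs `σᵢ`. -/
def flip {p : ℕ} (σ : Fin p → ℤˣ) (x : Metric.sphere (0 : EuclideanSpace ℝ (Fin p)) 1) :
    Metric.sphere (0 : EuclideanSpace ℝ (Fin p)) 1 :=
  ⟨WithLp.toLp 2 fun i => ((σ i : ℤ) : ℝ) * x.1 i, by
    have h : ∀ i, (((σ i : ℤ) : ℝ) * x.1 i) ^ 2 = x.1 i ^ 2 := fun i => by
      rcases Int.units_eq_one_or (σ i) with h | h <;> simp [h]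
    have hx := x.2
    rw [mem_sphere_zero_iff_norm, EuclideanSpace.norm_eq] at hx ⊢
    simpa only [Real.norm_eq_abs, sq_abs, h] using hx⟩

/-- The map `s ↦ σ s` of the circle, for a sign `σ`. -/
def circleSign (σ : ℤˣ) (s : Circle) : Circle :=
  ⟨((σ : ℤ) : ℂ) * s, by
    refine mem_sphere_zero_iff_norm.2 ?_
    rcases Int.units_eq_one_or σ with h | h <;> simpa [h] using Circle.norm_coe s⟩

/-- The action of `ℤ/2 × ℤ/2 = {±1} × {±1}`. The first generator `(-1, 1)` acts by
`ψ₁ : (x, y) ↦ (-x, y)` on `S^{p-1} × S^{q-1}` and by `(s, t) ↦ (-s, t)` on `S¹ × S¹`; the second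
generator `(1, -1)` acts by
`ψ₂ : (x, y) ↦ (-x₁, …, -x_k, x_{k+1}, …, x_p, -y₁, …, -y_q)` and by `(s, t) ↦ (s, -t)`. -/
instance : MulAction (ℤˣ × ℤˣ) (ModelCover k p q) where
  smul g x := (flip (fun i => if (i : ℕ) < k then g.1 * g.2 else g.1) x.1, flip (fun _ => g.2) x.2.1,
    circleSign g.1 x.2.2.1, circleSign g.2 x.2.2.2)
  one_smul x := by
    refine Prod.ext ?_ (Prod.ext ?_ (Prod.ext ?_ ?_))
    · refine Subtype.ext (PiLp.ext fun i => ?_)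
      change (((if (i : ℕ) < k then 1 * 1 else 1 : ℤˣ) : ℤ) : ℝ) * x.1.1 i = x.1.1 i
      simp
    · refine Subtype.ext (PiLp.ext fun i => ?_)
      change (((1 : ℤˣ) : ℤ) : ℝ) * x.2.1.1 i = x.2.1.1 i
      simp
    · refine Circle.ext ?_
      change (((1 : ℤˣ) : ℤ) : ℂ) * x.2.2.1 = x.2.2.1
      simp
    · refine Circle.ext ?_
      change (((1 : ℤˣ) : ℤ) : ℂ) * x.2.2.2 = x.2.2.2
      simp
  mul_smul g h x := by
    refine Prod.ext ?_ (Prod.ext ?_ (Prod.ext ?_ ?_))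
    · refine Subtype.ext (PiLp.ext fun i => ?_)
      change (((if (i : ℕ) < k then (g.1 * h.1) * (g.2 * h.2) else g.1 * h.1 : ℤˣ) : ℤ) : ℝ) * x.1.1 i =
        (((if (i : ℕ) < k then g.1 * g.2 else g.1 : ℤˣ) : ℤ) : ℝ) *
        ((((if (i : ℕ) < k then h.1 * h.2 else h.1 : ℤˣ) : ℤ) : ℝ) * x.1.1 i)
      split_ifs <;> push_cast <;> ring
    · refine Subtype.ext (PiLp.ext fun i => ?_)
      change (((g.2 * h.2 : ℤˣ) : ℤ) : ℝ) * x.2.1.1 i = ((g.2 : ℤ) : ℝ) * (((h.2 : ℤ) : ℝ) * x.2.1.1 i)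
      push_cast; ring
    · refine Circle.ext ?_
      change (((g.1 * h.1 : ℤˣ) : ℤ) : ℂ) * x.2.2.1 = ((g.1 : ℤ) : ℂ) * (((h.1 : ℤ) : ℂ) * x.2.2.1)
      push_cast; ring
    · refine Circle.ext ?_
      change (((g.2 * h.2 : ℤˣ) : ℤ) : ℂ) * x.2.2.2 = ((g.2 : ℤ) : ℂ) * (((h.2 : ℤ) : ℂ) * x.2.2.2)
      push_cast; ring

/-- The inclusion in the ambient space `ℝ^p × ℝ^q × ℂ × ℂ`. -/
def incl (x : ModelCover k p q) :
    EuclideanSpace ℝ (Fin p) × EuclideanSpace ℝ (Fin q) × ℂ × ℂ :=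
  (x.1.1, x.2.1.1, (x.2.2.1 : ℂ), (x.2.2.2 : ℂ))

theorem isEmbedding_incl : Topology.IsEmbedding (incl k p q) :=
  Topology.IsEmbedding.subtypeVal.prodMap (Topology.IsEmbedding.subtypeVal.prodMap
    (Topology.IsEmbedding.subtypeVal.prodMap Topology.IsEmbedding.subtypeVal))

theorem hasLocalParam (x : ModelCover k p q) :
    HasLocalParam (incl k p q) (EuclideanSpace ℝ (Fin (p + q))) x := by
  let f : EuclideanSpace ℝ (Fin p) × EuclideanSpace ℝ (Fin q) × ℂ × ℂ → ℝ × ℝ × ℝ × ℝ := fun z =>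
    (‖z.1‖ ^ 2 - 1, ‖z.2.1‖ ^ 2 - 1, ‖z.2.2.1‖ ^ 2 - 1, ‖z.2.2.2‖ ^ 2 - 1)
  have h1 : ContDiff ℝ ∞ fun z : EuclideanSpace ℝ (Fin p) × EuclideanSpace ℝ (Fin q) × ℂ × ℂ =>
      ‖z.1‖ ^ 2 - 1 := (contDiff_fst.norm_sq ℝ).sub contDiff_const
  have h2 : ContDiff ℝ ∞ fun z : EuclideanSpace ℝ (Fin p) × EuclideanSpace ℝ (Fin q) × ℂ × ℂ =>
      ‖z.2.1‖ ^ 2 - 1 := (contDiff_snd.fst.norm_sq ℝ).sub contDiff_const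
  have h3 : ContDiff ℝ ∞ fun z : EuclideanSpace ℝ (Fin p) × EuclideanSpace ℝ (Fin q) × ℂ × ℂ =>
      ‖z.2.2.1‖ ^ 2 - 1 := (contDiff_snd.snd.fst.norm_sq ℝ).sub contDiff_const
  have h4 : ContDiff ℝ ∞ fun z : EuclideanSpace ℝ (Fin p) × EuclideanSpace ℝ (Fin q) × ℂ × ℂ =>
      ‖z.2.2.2‖ ^ 2 - 1 := (contDiff_snd.snd.snd.norm_sq ℝ).sub contDiff_const
  have hf : ContDiff ℝ ∞ f := h1.prodMk (h2.prodMk (h3.prodMk h4))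
  have hn : ∀ (V : Type) [NormedAddCommGroup V] (v : V), ‖v‖ ^ 2 - 1 = 0 ↔ ‖v‖ = 1 := by
    intro V _ v
    rw [sub_eq_zero, pow_eq_one_iff_of_nonneg (norm_nonneg v) two_ne_zero]
  refine hasLocalParam_levelSet (p + q) (isEmbedding_incl k p q).injective (f := f) hf ?_ x ?_ ?_
  · ext ⟨z1, z2, z3, z4⟩
    simp only [Set.mem_preimage, Set.mem_singleton_iff, f, Prod.mk_eq_zero, hn]
    constructor
    · rintro ⟨y, hy⟩
      obtain ⟨rfl, rfl, rfl, rfl⟩ : y.1.1 = z1 ∧ y.2.1.1 = z2 ∧ (y.2.2.1 : ℂ) = z3 ∧ (y.2.2.2 : ℂ) = z4 := by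
        simpa [incl] using hy
      exact ⟨mem_sphere_zero_iff_norm.1 y.1.2, mem_sphere_zero_iff_norm.1 y.2.1.2,
        Circle.norm_coe y.2.2.1, Circle.norm_coe y.2.2.2⟩
    · rintro ⟨a1, a2, a3, a4⟩
      exact ⟨(⟨z1, by simpa using a1⟩, ⟨z2, by simpa using a2⟩, 
        ⟨z3, mem_sphere_zero_iff_norm.2 a3⟩, ⟨z4, mem_sphere_zero_iff_norm.2 a4⟩), rfl⟩
  · rw [eq_top_iff]
    rintro ⟨r1, r2, r3, r4⟩ -
    -- move each factor radially
    refine ⟨((r1 / 2) • x.1.1, (r2 / 2) • x.2.1.1, (r3 / 2) • (x.2.2.1 : ℂ), (r4 / 2) • (x.2.2.2 : ℂ)), ?_⟩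
    have hfst := hasFDerivAt_fst (𝕜 := ℝ) (p := incl k p q x)
    have hsnd := hasFDerivAt_snd (𝕜 := ℝ) (p := incl k p q x)
    have hd := (hfst.norm_sq.sub_const 1).prodMk
      ((hsnd.fst.norm_sq.sub_const 1).prodMk
      ((hsnd.snd.fst.norm_sq.sub_const 1).prodMk (hsnd.snd.snd.norm_sq.sub_const 1)))
    have hd' := HasFDerivAt.fderiv (f := f) hd
    rw [hd']
    have n1 : ‖x.1.1‖ = 1 := mem_sphere_zero_iff_norm.1 x.1.2
    have n2 : ‖x.2.1.1‖ = 1 := mem_sphere_zero_iff_norm.1 x.2.1.2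
    have n3 : ‖(x.2.2.1 : ℂ)‖ = 1 := Circle.norm_coe x.2.2.1
    have n4 : ‖(x.2.2.2 : ℂ)‖ = 1 := Circle.norm_coe x.2.2.2
    simp only [incl, ContinuousLinearMap.prod_apply, smul_apply,
      ContinuousLinearMap.comp_apply, ContinuousLinearMap.coe_fst', ContinuousLinearMap.coe_snd',
      innerSL_apply_apply, inner_smul_right, real_inner_self_eq_norm_sq, n1, n2, n3, n4,
      ContinuousLinearMap.coe_coe]
    ext <;> simp <;> ring
  · simp
    ring

end ModelCover

/-- `N_k(p,q) = (S^{p-1} × S^{q-1}) ×_{ℤ/2 × ℤ/2} (S¹ × S¹)`, with the quotient topology. -/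
def Nkpq (k p q : ℕ) : Type := MulAction.orbitRel.Quotient (ℤˣ × ℤˣ) (ModelCover k p q)

namespace Nkpq

variable (k p q : ℕ)

instance : TopologicalSpace (Nkpq k p q) := inferInstanceAs (TopologicalSpace (Quotient _))

/-- The quotient map onto `N_k(p,q)`. -/
def proj (x : ModelCover k p q) : Nkpq k p q :=
  Quotient.mk (MulAction.orbitRel (ℤˣ × ℤˣ) (ModelCover k p q)) x

theorem exists_chart (x : Nkpq k p q) :
    ∃ e ∈ smoothCharts (ModelCover.incl k p q) (proj k p q) (p + q), x ∈ e.source := by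
  refine exists_smoothChart (ModelCover.isEmbedding_incl k p q) ?_ ?_ (p + q)
    (ModelCover.hasLocalParam k p q) x
  · rintro ⟨σ, τ⟩ x h
    have key : ∀ (σ : ℤˣ) (s : Circle), ModelCover.circleSign σ s = s → σ = 1 := by
      intro σ s h
      have h3 : ((σ : ℤ) : ℂ) * s = s := congrArg Subtype.val h
      have h5 : ((σ : ℤ) : ℂ) = 1 := mul_right_cancel₀ (Circle.coe_ne_zero s) (by rw [h3, one_mul])
      have h6 : (σ : ℤ) = 1 := by exact_mod_cast h5
      exact Units.ext h6
    exact Prod.ext (key σ x.2.2.1 (congrArg (fun y => y.2.2.1) h))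
      (key τ x.2.2.2 (congrArg (fun y => y.2.2.2) h))
  · rintro ⟨σ, τ⟩
    refine ⟨fun z => (WithLp.toLp 2 fun i => (((if (i : ℕ) < k then σ * τ else σ : ℤˣ) : ℤ) : ℝ) * z.1 i,
      WithLp.toLp 2 fun i => ((τ : ℤ) : ℝ) * z.2.1 i,
      ((σ : ℤ) : ℂ) * z.2.2.1, ((τ : ℤ) : ℂ) * z.2.2.2), ?_, fun x => rfl⟩
    fun_prop

/-- The smooth manifold `N_k(p,q)`: the quotient map from `S^{p-1} × S^{q-1} × S¹ × S¹` is a local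
diffeomorphism. -/
instance : ChartedSpace (EuclideanSpace ℝ (Fin (p + q))) (Nkpq k p q) :=
  smoothQuotientChartedSpace (ModelCover.incl k p q) (proj k p q) (p + q) (exists_chart k p q)

instance : IsManifold 𝓘(ℝ, EuclideanSpace ℝ (Fin (p + q))) ∞ (Nkpq k p q) :=
  smoothQuotient_isManifold (ModelCover.incl k p q) (proj k p q) (p + q) (exists_chart k p q)

end Nkpq

end

/-! Both directions pass through `QuadricData.NormalForm`: p of the vectors are e₁ + aᵢe₂ with
integers aᵢ, the other q are all e₂, and c = c₁e₁ + c₂e₂ with c₁ > 0 and aᵢc₁ < c₂. Read along e₁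
and e₂, the equations of R_Γ put the first p variables on a sphere of radius √c₁ and the other q on
a sphere of squared radius c₂ − ∑aᵢuᵢ², which is positive. Rescaling turns R_Γ into S^{p-1} ×
S^{q-1}. The torus T_Γ consists of the points with coordinates s·t^{aᵢ} and t, and D_Γ of those with
signs s = τ₁, t = τ₂. Only the parity of aᵢ matters for τ₁τ₂^{aᵢ}, so N_Γ is N_k(p,q) with k the
number of odd aᵢ, listed first (`NormalForm.nonempty_diffeomorph`).

A normal form is forced as follows. Compactness excludes nontrivial relations with nonnegative
coefficients among the γₖ (`eq_zero_of_sum_eq_zero`). Hence no γₖ is parallel to c, there are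
vectors on both sides of c, and det(γᵢ, γⱼ) > 0 whenever i and j lie on the two sides in the right
order (`planeDet_γ_γ_pos`). For such a pair R_Γ has a point supported on {i, j}, and injectivity of
i_Γ then makes γᵢ, γⱼ a basis of L (`exists_int_dotProduct_eq`, `exists_int_planeDet_eq`). All these
cross determinants are therefore one number δ. Relative to a fixed pair i₀, j₀ the vectors on one
side are γᵢ = γ_{i₀} + aγ_{j₀}, those on the other γⱼ = γ_{j₀} + bγ_{i₀}, and δ = (1 − ab)δ gives ab
= 0 for every choice of i and j. So all b vanish or all a vanish, and either case is a normal form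
(`exists_normalForm_of_injective`).

For the converse, take k vectors (1,1), p − k vectors (1,0), q vectors (0,1) and c = (1,2).
Compactness comes from the diffeomorphism with the model. For every normal form i_Γ is an injective
immersion, because a point (u, z) is a smooth function of its image once the signs of one nonzero
coordinate in each group are known (`recover_immersion`). -/

noncomputable section

/-! ### Inverse functions and immersions in charts -/

section InverseFunction

variable {E V : Type*} [NormedAddCommGroup E] [NormedSpace ℝ E] [NormedAddCommGroup V]
  [NormedSpace ℝ V]

/-- Inverse function theorem for a map that is smooth on an open set: a local inverse that is smooth
on its whole domain. -/
theorem exists_openPartialHomeomorph_of_contDiffOn [CompleteSpace E] {Ω : Set E} (hΩ : IsOpen Ω)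
    {Φ : E → V} (hΦ : ContDiffOn ℝ ∞ Φ Ω) {x : E} (hx : x ∈ Ω) (l : E ≃L[ℝ] V)
    (hl : fderiv ℝ Φ x = l) :
    ∃ e : OpenPartialHomeomorph E V, x ∈ e.source ∧ e.source ⊆ Ω ∧ (e : E → V) = Φ ∧
      ContDiffOn ℝ ∞ e.symm e.target := by
  have hat : ∀ y ∈ Ω, ContDiffAt ℝ ∞ Φ y := fun y hy => hΦ.contDiffAt (hΩ.mem_nhds hy)
  have hd : ∀ y ∈ Ω, HasFDerivAt Φ (fderiv ℝ Φ y) y := fun y hy =>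
    ((hat y hy).differentiableAt (by simp)).hasFDerivAt
  have hdx : HasFDerivAt Φ (l : E →L[ℝ] V) x := hl ▸ hd x hx
  let e0 := (hat x hx).toOpenPartialHomeomorph Φ hdx (by simp)
  have he0x : x ∈ e0.source := (hat x hx).mem_toOpenPartialHomeomorph_source hdx (by simp)
  -- Shrinking to the open set where the derivative is invertible makes the inverse smooth on the
  -- whole target, not only at the image of `x`.
  let O : Set E := Ω ∩ fderiv ℝ Φ ⁻¹'
    Set.range (ContinuousLinearEquiv.toContinuousLinearMap : (E ≃L[ℝ] V) → E →L[ℝ] V)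
  have hO : IsOpen O :=
    (hΦ.continuousOn_fderiv_of_isOpen hΩ (by simp)).isOpen_inter_preimage hΩ
      (ContinuousLinearEquiv.isOpen (𝕜 := ℝ))
  let e := e0.restrOpen O hO
  have hes : e.source = e0.source ∩ O := rfl
  refine ⟨e, ⟨he0x, hx, l, hl.symm⟩, fun y hy => hy.2.1, rfl, fun a ha => ?_⟩
  have h1 : e.symm a ∈ e.source := e.map_target ha
  obtain ⟨g, hg⟩ := h1.2.2
  refine (e.contDiffAt_symm ha (f₀' := g) ?_ (hat _ h1.2.1)).contDiffWithinAt
  rw [hg]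
  exact hd _ h1.2.1

/-- A map between finite-dimensional manifolds (with values in a vector space) whose derivative in a
chart is injective is an immersion. -/
theorem isImmersionAtOfComplement_of_injective_fderiv [FiniteDimensional ℝ E]
    [FiniteDimensional ℝ V] (F : Type*) [NormedAddCommGroup F] [NormedSpace ℝ F]
    [FiniteDimensional ℝ F] (hdim : Module.finrank ℝ V = Module.finrank ℝ E + Module.finrank ℝ F)
    {M : Type*} [TopologicalSpace M] [ChartedSpace E M] [IsManifold 𝓘(ℝ, E) ∞ M] {f : M → V}
    {x : M} (e : OpenPartialHomeomorph M E) (he : e ∈ IsManifold.maximalAtlas 𝓘(ℝ, E) ∞ M)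
    (hx : x ∈ e.source) (hf : ContDiffOn ℝ ∞ (f ∘ e.symm) e.target)
    (hinj : Function.Injective (fderiv ℝ (f ∘ e.symm) (e x))) :
    Manifold.IsImmersionAtOfComplement F 𝓘(ℝ, E) 𝓘(ℝ, V) ∞ f x := by
  have : CompleteSpace E := FiniteDimensional.complete ℝ E
  have : CompleteSpace F := FiniteDimensional.complete ℝ F
  set g : E → V := f ∘ e.symm with hg
  set A : E →L[ℝ] V := fderiv ℝ g (e x) with hA
  obtain ⟨l, hl⟩ : ∃ l : (E × F) ≃L[ℝ] V, ∀ v, l (v, 0) = A v := by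
    obtain ⟨C, hC⟩ := Submodule.exists_isCompl (A : E →ₗ[ℝ] V).range
    have h1 : Module.finrank ℝ (A : E →ₗ[ℝ] V).range = Module.finrank ℝ E :=
      LinearMap.finrank_range_of_inj hinj
    have h2 := Submodule.finrank_add_eq_of_isCompl hC
    let l1 : E ≃ₗ[ℝ] (A : E →ₗ[ℝ] V).range := LinearEquiv.ofInjective (A : E →ₗ[ℝ] V) hinj
    let l2 : F ≃ₗ[ℝ] C := LinearEquiv.ofFinrankEq _ _ (by omega)
    refine ⟨((l1.prodCongr l2).trans (Submodule.prodEquivOfIsCompl _ C hC)).toContinuousLinearEquiv,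
      fun v => ?_⟩
    simp [l1]
  -- Thickening `g` in directions complementary to the image of its derivative gives a map with
  -- derivative `l` at `(e x, 0)`; its local inverse straightens `g` to `v ↦ (v, 0)`.
  let Φ : E × F → V := fun z => g z.1 + l (0, z.2)
  have hΩ : IsOpen (e.target ×ˢ (Set.univ : Set F)) := e.open_target.prod isOpen_univ
  have hΦ : ContDiffOn ℝ ∞ Φ (e.target ×ˢ Set.univ) := by
    refine (hf.comp contDiff_fst.contDiffOn fun z hz => hz.1).add ?_
    exact (l.contDiff.comp (contDiff_const.prodMk contDiff_snd)).contDiffOn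
  have hgd : HasFDerivAt g A (e x) :=
    ((hf.contDiffAt (e.open_target.mem_nhds (e.map_source hx))).differentiableAt
      (by simp)).hasFDerivAt
  have hΦd : fderiv ℝ Φ (e x, 0) = (l : E × F →L[ℝ] V) := by
    have h1 : HasFDerivAt (fun z : E × F => g z.1) (A.comp (ContinuousLinearMap.fst ℝ E F))
        (e x, (0 : F)) := HasFDerivAt.comp (e x, (0 : F)) (g := g) hgd hasFDerivAt_fst
    have h2 : HasFDerivAt (fun z : E × F => l (0, z.2))
        ((l : E × F →L[ℝ] V).comp ((ContinuousLinearMap.inr ℝ E F).comp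
          (ContinuousLinearMap.snd ℝ E F))) (e x, (0 : F)) :=
      ((l : E × F →L[ℝ] V).comp ((ContinuousLinearMap.inr ℝ E F).comp
          (ContinuousLinearMap.snd ℝ E F))).hasFDerivAt
    rw [HasFDerivAt.fderiv (f := Φ) (h1.add h2)]
    refine ContinuousLinearMap.ext fun z => ?_
    have h3 : l z = l (z.1, 0) + l (0, z.2) := by rw [← map_add]; simp
    simp [h3, hl]
  obtain ⟨ψ, hψx, hψΩ, hψΦ, hψs⟩ := exists_openPartialHomeomorph_of_contDiffOn hΩ hΦ
    (x := (e x, 0)) ⟨e.map_source hx, trivial⟩ l hΦd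
  -- A chart of `V` must take values in `V`, so the straightening map is followed by `l`.
  let χ : OpenPartialHomeomorph V V := ψ.symm.transHomeomorph l.toHomeomorph
  have hχs : χ.source = ψ.target := rfl
  have hχ : χ ∈ IsManifold.maximalAtlas 𝓘(ℝ, V) ∞ V := by
    refine OpenPartialHomeomorph.mem_maximalAtlas_of_contMDiffOn _ ?_ ?_
    · rw [contMDiffOn_iff_contDiffOn]
      exact l.contDiff.comp_contDiffOn hψs
    · rw [contMDiffOn_iff_contDiffOn]
      change ContDiffOn ℝ ∞ (ψ ∘ l.symm) (l.symm ⁻¹' ψ.source)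
      rw [hψΦ]
      exact (hΦ.mono hψΩ).comp l.symm.contDiff.contDiffOn fun z hz => hz
  let O : Set E := {v | (v, (0 : F)) ∈ ψ.source}
  have hO : IsOpen O := ψ.open_source.preimage (by fun_prop)
  -- The domain is cut down so that `f` maps it into the source of `χ`.
  let e' := e.restr (e.source ∩ e ⁻¹' O)
  have hOs : IsOpen (e.source ∩ e ⁻¹' O) := e.isOpen_inter_preimage hO
  have he's : e'.source = e.source ∩ (e.source ∩ e ⁻¹' O) := by
    rw [OpenPartialHomeomorph.restr_source, hOs.interior_eq]
  have he' : e' ∈ IsManifold.maximalAtlas 𝓘(ℝ, E) ∞ M := restr_mem_maximalAtlas _ he hOs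
  have hval : ∀ v, g v = ψ (v, 0) := fun v => by
    have h0 : ((0 : E), (0 : F)) = 0 := rfl
    rw [hψΦ]; simp [Φ, h0]
  have hfe : ∀ y ∈ e'.source, f y = ψ (e y, 0) := fun y hy => by
    rw [he's] at hy
    rw [← hval, hg, Function.comp_apply, e.left_inv hy.1]
  refine Manifold.IsImmersionAtOfComplement.mk_of_charts l e' χ ?_ ?_ he' hχ ?_ ?_
  · rw [he's]; exact ⟨hx, hx, hψx⟩
  · rw [hχs, hfe x (by rw [he's]; exact ⟨hx, hx, hψx⟩)]
    exact ψ.map_source hψx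
  · intro y hy
    change f y ∈ ψ.target
    rw [hfe y hy]
    rw [he's] at hy
    exact ψ.map_source hy.2.2
  · intro v hv
    simp only [OpenPartialHomeomorph.extend, mfld_simps] at hv ⊢
    have hv2 := e'.map_target (x := v) (by simpa [e', mfld_simps] using hv)
    rw [he's] at hv2
    have hv1 : v ∈ e.target := hv.1
    have hv3 : (v, (0 : F)) ∈ ψ.source := by
      have := hv2.2.2
      change (e (e.symm v), (0 : F)) ∈ ψ.source at this
      rwa [e.right_inv hv1] at this
    change l (ψ.symm (g v)) = l (v, 0)
    rw [hval, ψ.left_inv hv3]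

end InverseFunction

/-! ### Smooth maps between quotients of submanifolds -/

section SmoothQuotient

variable {E : Type*} [NormedAddCommGroup E] [NormedSpace ℝ E] {X N : Type*} [TopologicalSpace N]
  {ι : X → E} {π : X → N} {d : ℕ} (h : ∀ n : N, ∃ e ∈ smoothCharts ι π d, n ∈ e.source)
  {E' : Type*} [NormedAddCommGroup E'] [NormedSpace ℝ E'] {X' N' : Type*} [TopologicalSpace N']
  {ι' : X' → E'} {π' : X' → N'} {d' : ℕ}
  (h' : ∀ n : N', ∃ e ∈ smoothCharts ι' π' d', n ∈ e.source)

/-- A map between subsets of normed spaces is *ambiently smooth* if it is locally the restriction of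
a smooth map between open subsets of the ambient spaces. -/
def AmbientSmooth (ι : X → E) (ι' : X' → E') (f : X → X') : Prop :=
  ∀ x, ∃ (U : Set E) (F : E → E'), IsOpen U ∧ ι x ∈ U ∧ ContDiffOn ℝ ∞ F U ∧
    ∀ y, ι y ∈ U → ι' (f y) = F (ι y)

theorem AmbientSmooth.continuous [TopologicalSpace X] [TopologicalSpace X'] {f : X → X'}
    (hf : AmbientSmooth ι ι' f) (hι : Continuous ι) (hι' : Topology.IsInducing ι') :
    Continuous f := by
  rw [hι'.continuous_iff, continuous_iff_continuousAt]
  intro x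
  obtain ⟨U, F, hU, hxU, hF, hFf⟩ := hf x
  have h1 : ContinuousAt (F ∘ ι) x :=
    ContinuousAt.comp (hF.continuousOn.continuousAt (hU.mem_nhds hxU)) hι.continuousAt
  refine h1.congr ?_
  filter_upwards [hι.continuousAt.eventually (hU.mem_nhds hxU)] with y hy
  exact (hFf y hy).symm

/-- In charts `g` is locally `F' ∘ F ∘ (ι ∘ s)`, where `s` lifts the inverse of the source chart,
`F` extends `f` to the ambient space, and `F'` extends the target chart. Continuity of `g` keeps
nearby points inside the domain of the target chart. -/
theorem AmbientSmooth.contMDiff_quotient {f : X → X'} (hf : AmbientSmooth ι ι' f) {g : N → N'}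
    (hg : Continuous g) (hgf : ∀ x, g (π x) = π' (f x)) :
    let _ := smoothQuotientChartedSpace ι π d h
    let _ := smoothQuotientChartedSpace ι' π' d' h'
    ContMDiff 𝓘(ℝ, EuclideanSpace ℝ (Fin d)) 𝓘(ℝ, EuclideanSpace ℝ (Fin d')) ∞ g := by
  intro i1 i2 n
  rw [contMDiffAt_iff]
  refine ⟨hg.continuousAt, ?_⟩
  simp only [mfld_simps]
  rw [contDiffWithinAt_univ]
  set e := chartAt (EuclideanSpace ℝ (Fin d)) n
  set e' := chartAt (EuclideanSpace ℝ (Fin d')) (g n)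
  have he : e ∈ smoothCharts ι π d := chart_mem_atlas _ n
  have he' : e' ∈ smoothCharts ι' π' d' := chart_mem_atlas _ (g n)
  have hn : n ∈ e.source := mem_chart_source _ n
  have hn' : g n ∈ e'.source := mem_chart_source _ (g n)
  have hv := e.map_source hn
  obtain ⟨W, s, hW, hvW, hWt, hs, hπ⟩ := he.2 _ hv
  have hsn : g n = π' (f (s (e n))) := by rw [← hgf, hπ _ hvW, e.left_inv hn]
  obtain ⟨U, F, hU, hxU, hF, hFf⟩ := hf (s (e n))
  obtain ⟨U', F', hU', hxU', hF', hFe⟩ := he'.1 (f (s (e n))) (hsn ▸ hn')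
  have hsc : ContDiffAt ℝ ∞ (ι ∘ s) (e n) := hs.contDiffAt (hW.mem_nhds hvW)
  have hFs : ContDiffAt ℝ ∞ (F ∘ (ι ∘ s)) (e n) :=
    ContDiffAt.comp _ (hF.contDiffAt (hU.mem_nhds hxU)) hsc
  have hval : (F ∘ (ι ∘ s)) (e n) = ι' (f (s (e n))) := (hFf _ hxU).symm
  have hxU'' : (F ∘ (ι ∘ s)) (e n) ∈ U' := hval ▸ hxU'
  have hc : ContDiffAt ℝ ∞ (F' ∘ (F ∘ (ι ∘ s))) (e n) :=
    ContDiffAt.comp _ (hF'.contDiffAt (hU'.mem_nhds hxU'')) hFs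
  refine hc.congr_of_eventuallyEq ?_
  have hge : ContinuousAt (g ∘ e.symm) (e n) :=
    ContinuousAt.comp hg.continuousAt (e.symm.continuousAt hv)
  filter_upwards [hsc.continuousAt.eventually (hU.mem_nhds hxU),
    hFs.continuousAt.eventually (hU'.mem_nhds hxU''),
    hge.eventually (e'.open_source.mem_nhds (by simpa [e.left_inv hn] using hn')),
    hW.mem_nhds hvW] with w h1 h2 h3 h4
  have h5 : g (e.symm w) = π' (f (s w)) := by rw [← hgf, hπ w h4]
  have h6 : F (ι (s w)) = ι' (f (s w)) := (hFf _ h1).symm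
  simp only [Function.comp_apply] at h2 h3 ⊢
  rw [h6] at h2 ⊢
  rw [hFe _ h2 (h5 ▸ h3), h5]

/-- Inverse ambiently smooth maps that respect the fibres of the projections induce a
diffeomorphism. -/
theorem nonempty_diffeomorph_of_ambientSmooth [TopologicalSpace X] [TopologicalSpace X']
    (hι : Topology.IsInducing ι) (hι' : Topology.IsInducing ι')
    (hπ : Topology.IsQuotientMap π) (hπ' : Topology.IsQuotientMap π')
    (f : X ≃ X') (hf : AmbientSmooth ι ι' f) (hf' : AmbientSmooth ι' ι f.symm)
    (hff : ∀ x y, π x = π y ↔ π' (f x) = π' (f y)) :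
    let _ := smoothQuotientChartedSpace ι π d h
    let _ := smoothQuotientChartedSpace ι' π' d' h'
    Nonempty (N ≃ₘ⟮𝓘(ℝ, EuclideanSpace ℝ (Fin d)), 𝓘(ℝ, EuclideanSpace ℝ (Fin d'))⟯ N') := by
  intro i1 i2
  let g : N → N' := fun n => π' (f (hπ.surjective n).choose)
  have hg : ∀ x, g (π x) = π' (f x) := fun x =>
    (hff _ _).1 (hπ.surjective (π x)).choose_spec
  let g' : N' → N := fun n => π (f.symm (hπ'.surjective n).choose)
  have hg' : ∀ x, g' (π' x) = π (f.symm x) := fun x =>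
    (hff _ _).2 (by simpa using (hπ'.surjective (π' x)).choose_spec)
  have hgc : Continuous g := hπ.continuous_iff.2 (by
    rw [show g ∘ π = π' ∘ f from funext hg]
    exact hπ'.continuous.comp (hf.continuous hι.continuous hι'))
  have hgc' : Continuous g' := hπ'.continuous_iff.2 (by
    rw [show g' ∘ π' = π ∘ f.symm from funext hg']
    exact hπ.continuous.comp (hf'.continuous hι'.continuous hι))
  refine ⟨⟨⟨g, g', fun n => ?_, fun n => ?_⟩, hf.contMDiff_quotient h h' hgc hg,
    hf'.contMDiff_quotient h' h hgc' hg'⟩⟩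
  · obtain ⟨x, rfl⟩ := hπ.surjective n
    rw [hg, hg', f.symm_apply_apply]
  · obtain ⟨x, rfl⟩ := hπ'.surjective n
    rw [hg', hg, f.apply_symm_apply]

/-- A map on the quotient induced by an ambient smooth map is an immersion if the points of `X` can
be recovered locally from their images by a smooth map. -/
theorem isImmersion_of_localLeftInverse {V : Type*} [NormedAddCommGroup V] [NormedSpace ℝ V]
    [FiniteDimensional ℝ V] (hdim : d ≤ Module.finrank ℝ V)
    {g : N → V} {G : E → V} (hG : ContDiff ℝ ∞ G) (hgG : ∀ x, g (π x) = G (ι x))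
    (hK : ∀ x, ∃ K : V → E, ContDiffAt ℝ ∞ K (G (ι x)) ∧ ∀ᶠ z in 𝓝 (ι x), ∀ y, ι y = z →
      K (G z) = z) :
    let _ := smoothQuotientChartedSpace ι π d h
    Manifold.IsImmersion 𝓘(ℝ, EuclideanSpace ℝ (Fin d)) 𝓘(ℝ, V) ∞ g := by
  intro i1
  have i2 := smoothQuotient_isManifold ι π d h
  suffices Manifold.IsImmersionOfComplement
      (EuclideanSpace ℝ (Fin (Module.finrank ℝ V - d))) 𝓘(ℝ, EuclideanSpace ℝ (Fin d)) 𝓘(ℝ, V) ∞ g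
    from this.isImmersion
  intro n
  obtain ⟨e, he, hn⟩ := h n
  have hlift : ∀ w ∈ e.target, ContDiffAt ℝ ∞ (g ∘ e.symm) w := by
    intro w hw
    obtain ⟨W, s, hW, hvW, hWt, hs, hπs⟩ := he.2 _ hw
    have : ContDiffAt ℝ ∞ (G ∘ (ι ∘ s)) w :=
      hG.contDiffAt.comp _ (hs.contDiffAt (hW.mem_nhds hvW))
    refine this.congr_of_eventuallyEq ?_
    filter_upwards [hW.mem_nhds hvW] with w hw
    simp only [Function.comp_apply]
    rw [← hπs w hw, hgG]
  refine isImmersionAtOfComplement_of_injective_fderiv _ (by simp; omega) e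
    (IsManifold.subset_maximalAtlas he) hn (fun w hw => (hlift w hw).contDiffWithinAt) ?_
  have hv := e.map_source hn
  obtain ⟨W, s, hW, hvW, hWt, hs, hπs⟩ := he.2 _ hv
  obtain ⟨K, hKc, hK⟩ := hK (s (e n))
  have hsn : π (s (e n)) = n := by rw [hπs _ hvW, e.left_inv hn]
  obtain ⟨U, F, hU, hxU, hF, hFe⟩ := he.1 (s (e n)) (by rw [hsn]; exact hn)
  have hsc : ContDiffAt ℝ ∞ (ι ∘ s) (e n) := hs.contDiffAt (hW.mem_nhds hvW)
  have hKs : K (G (ι (s (e n)))) = ι (s (e n)) := hK.self_of_nhds _ rfl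
  have hval : (g ∘ e.symm) (e n) = G (ι (s (e n))) := by
    simp only [Function.comp_apply]
    rw [← hπs _ hvW, hgG]
  have hFK : ContDiffAt ℝ ∞ (F ∘ K) ((g ∘ e.symm) (e n)) := by
    rw [hval]
    exact ContDiffAt.comp _ (by rw [hKs]; exact hF.contDiffAt (hU.mem_nhds hxU)) hKc
  -- `K` returns from the image to the point of `X`, and `F` from there to the chart. The chain rule
  -- for this local left inverse makes the derivative of `g` in the chart injective.
  have hid : (F ∘ K) ∘ (g ∘ e.symm) =ᶠ[𝓝 (e n)] id := by
    filter_upwards [hW.mem_nhds hvW, hsc.continuousAt.eventually hK,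
      hsc.continuousAt.eventually (hU.mem_nhds hxU)] with w h1 h2 h3
    have h2 : K (G (ι (s w))) = ι (s w) := h2 _ rfl
    simp only [Function.comp_apply, id]
    rw [← hπs w h1, hgG, h2, hFe _ h3 (by rw [hπs w h1]; exact e.map_target (hWt h1)), hπs w h1,
      e.right_inv (hWt h1)]
  have hcomp := fderiv_comp (𝕜 := ℝ) (e n) (hFK.differentiableAt (by simp))
    ((hlift _ hv).differentiableAt (by simp))
  rw [hid.fderiv_eq, fderiv_id] at hcomp
  intro a b hab
  have := fun z => congrArg (fun L => L z) hcomp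
  simp only [ContinuousLinearMap.id_apply, ContinuousLinearMap.comp_apply] at this
  rw [this a, this b, hab]

end SmoothQuotient

/-! ### Integer powers of signs and of points of the circle -/

theorem coe_units_zpow (τ : ℤˣ) (n : ℤ) : (((τ ^ n : ℤˣ) : ℤ) : ℂ) = ((τ : ℤ) : ℂ) ^ n := by
  have h : ∀ τ : ℤˣ, ((τ : ℤ) : ℂ) = ((Units.map (Int.castRingHom ℂ).toMonoidHom τ : ℂˣ) : ℂ) :=
    fun τ => rfl
  rw [h, map_zpow, Units.val_zpow_eq_zpow_val, ← h]

/-- This is where parity enters: a sign sees only whether the exponent is odd, so the integers aᵢ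
leave just their number of odd values behind. -/
theorem intUnits_zpow_eq_ite (τ : ℤˣ) (n : ℤ) : τ ^ n = if Odd n then τ else 1 := by
  split_ifs with h
  · obtain ⟨k, rfl⟩ := h
    rw [zpow_add, zpow_mul, zpow_ofNat, Int.units_sq, one_zpow, one_mul, zpow_one]
  · obtain ⟨k, rfl⟩ := Int.not_odd_iff_even.1 h
    rw [← two_mul, zpow_mul, zpow_ofNat, Int.units_sq, one_zpow]

/-- On the unit circle conjugation is inversion, so `unitPow`, which is smooth on all of ℂ, extends
the integer power there, also for negative exponents. -/
theorem unitPow_coe_circle (n : ℤ) (t : Circle) :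
    QuadricData.unitPow n (t : ℂ) = (t : ℂ) ^ n := by
  unfold QuadricData.unitPow
  split_ifs with h
  · rw [← zpow_natCast, Int.toNat_of_nonneg h]
  · rw [← Circle.coe_inv_eq_conj, ← zpow_natCast, Int.toNat_of_nonneg (by omega), Circle.coe_inv,
      inv_zpow, zpow_neg, inv_inv]

theorem Circle.exists_exp_two_pi (s : Circle) :
    ∃ θ : ℝ, (s : ℂ) = Complex.exp (2 * Real.pi * Complex.I * (θ : ℂ)) := by
  refine ⟨Complex.arg s / (2 * Real.pi), ?_⟩
  have h := Complex.norm_mul_exp_arg_mul_I (s : ℂ)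
  rw [Circle.norm_coe, Complex.ofReal_one, one_mul] at h
  conv_lhs => rw [← h]
  congr 1
  have := Real.pi_ne_zero
  push_cast
  field_simp

/-! ### The group D_Γ and the quotient map onto N_Γ -/

namespace QuadricData

variable {m d : ℕ} (Q : QuadricData m d)

theorem norm_torusPoint (φ : Fin d → ℝ) (k : Fin m) : ‖Q.torusPoint φ k‖ = 1 := by
  simp [torusPoint, Complex.norm_exp]

/-- `D_Γ` consists of all vectors of signs in `T_Γ`. -/
theorem mem_D_iff (ε : Fin m → ℤˣ) : ε ∈ Q.D ↔ (fun k => ((ε k : ℤ) : ℂ)) ∈ Q.T := by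
  constructor
  · rintro ⟨ψ, -, h⟩
    exact ⟨(1 / 2 : ℝ) • ψ, funext fun k => (h k).symm⟩
  · rintro ⟨φ, h⟩
    -- If the torus point of φ is a vector of signs, its square is 1, which says that 2φ pairs
    -- integrally with every γₖ.
    refine ⟨(2 : ℝ) • φ, fun l hl => ?_, fun k => ?_⟩
    · refine Submodule.span_induction (p := fun l _ => ∃ n : ℤ, l ⬝ᵥ ((2 : ℝ) • φ) = n)
        ?_ ⟨0, by simp⟩ ?_ ?_ hl
      · rintro _ ⟨k, rfl⟩
        have h1 : Q.torusPoint ((2 : ℝ) • φ) k = 1 := by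
          rw [two_smul, torusPoint_add, h, Pi.mul_apply]
          rcases Int.units_eq_one_or (ε k) with h | h <;> simp [h]
        have h2 : Complex.exp (2 * Real.pi * Complex.I * ((Q.γ k ⬝ᵥ ((2 : ℝ) • φ) : ℝ) : ℂ)) =
            Complex.exp (2 * Real.pi * Complex.I * ((0 : ℝ) : ℂ)) := by
          rw [Complex.ofReal_zero, mul_zero, Complex.exp_zero]; exact h1
        obtain ⟨n, hn⟩ := (exp_eq_iff _ _).1 h2
        exact ⟨n, by rw [hn, zero_add]⟩
      · rintro x y - - ⟨n, hn⟩ ⟨n', hn'⟩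
        exact ⟨n + n', by rw [add_dotProduct, hn, hn']; push_cast; rfl⟩
      · rintro a x - ⟨n, hn⟩
        exact ⟨a * n, by rw [← Int.cast_smul_eq_zsmul ℝ, smul_dotProduct, hn]; push_cast; rfl⟩
    · rw [smul_smul, show (1 / 2 : ℝ) * 2 = 1 by norm_num, one_smul, h]

theorem proj_eq_iff (x y : Q.R × Q.T) : Q.proj x = Q.proj y ↔ ∃ ε : Q.D, ε • y = x :=
  Quotient.eq.trans MulAction.orbitRel_apply

theorem proj_surjective : Function.Surjective Q.proj := Quotient.exists_rep

theorem isQuotientMap_proj : Topology.IsQuotientMap Q.proj := isQuotientMap_quotient_mk'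

theorem immersion_proj (x : Q.R × Q.T) :
    Q.immersion (Q.proj x) = fun k => (x.1.1 k : ℂ) * x.2.1 k := rfl

end QuadricData

theorem Nkpq.proj_eq_iff {k p q : ℕ} (x y : ModelCover k p q) :
    Nkpq.proj k p q x = Nkpq.proj k p q y ↔ ∃ g : ℤˣ × ℤˣ, g • y = x :=
  Quotient.eq.trans MulAction.orbitRel_apply

theorem Nkpq.isQuotientMap_proj (k p q : ℕ) : Topology.IsQuotientMap (Nkpq.proj k p q) :=
  isQuotientMap_quotient_mk'

instance (k p q : ℕ) : CompactSpace (Nkpq k p q) := by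
  have : CompactSpace (ModelCover k p q) := inferInstanceAs (CompactSpace
    (Metric.sphere (0 : EuclideanSpace ℝ (Fin p)) 1 ×
      Metric.sphere (0 : EuclideanSpace ℝ (Fin q)) 1 × Circle × Circle))
  exact Quotient.compactSpace

/-! ### Normal forms: the equations, the torus and the signs -/

/-- A presentation of a configuration of vectors in the plane as `e₁ + aᵢ e₂` (`i = 1, …, p`) and
`q` copies of `e₂`, with `c` on the left of the former and on the right of the latter. -/
structure QuadricData.NormalForm {m : ℕ} (Q : QuadricData m 2) (p q : ℕ) where
  /-- the splitting of the indices -/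
  σ : Fin p ⊕ Fin q ≃ Fin m
  /-- the coefficients -/
  a : Fin p → ℤ
  /-- the first basis vector -/
  e₁ : Fin 2 → ℝ
  /-- the second basis vector -/
  e₂ : Fin 2 → ℝ
  /-- the first coordinate of `c` -/
  c₁ : ℝ
  /-- the second coordinate of `c` -/
  c₂ : ℝ
  det_ne_zero : e₁ 0 * e₂ 1 - e₁ 1 * e₂ 0 ≠ 0
  γ_inl : ∀ i, Q.γ (σ (Sum.inl i)) = e₁ + (a i : ℝ) • e₂
  γ_inr : ∀ j, Q.γ (σ (Sum.inr j)) = e₂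
  c_eq : Q.c = c₁ • e₁ + c₂ • e₂
  c₁_pos : 0 < c₁
  lt_c₂ : ∀ i, a i * c₁ < c₂
  /-- `p` is positive -/
  i₀ : Fin p
  /-- `q` is positive -/
  j₀ : Fin q

namespace QuadricData.NormalForm

variable {m p q : ℕ} {Q : QuadricData m 2} (S : Q.NormalForm p q)

theorem exists_dotProduct (θ₁ θ₂ : ℝ) : ∃ φ : Fin 2 → ℝ, S.e₁ ⬝ᵥ φ = θ₁ ∧ S.e₂ ⬝ᵥ φ = θ₂ := by
  have := S.det_ne_zero
  -- Cramer's rule for the system with rows e₁ and e₂.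
  refine ⟨![(θ₁ * S.e₂ 1 - θ₂ * S.e₁ 1) / (S.e₁ 0 * S.e₂ 1 - S.e₁ 1 * S.e₂ 0),
    (S.e₁ 0 * θ₂ - S.e₂ 0 * θ₁) / (S.e₁ 0 * S.e₂ 1 - S.e₁ 1 * S.e₂ 0)], ?_, ?_⟩ <;>
  · simp only [dotProduct, Fin.sum_univ_two, Matrix.cons_val_zero, Matrix.cons_val_one]
    rw [mul_div_assoc', mul_div_assoc', ← add_div, div_eq_iff this]
    ring

theorem coords_unique {r₁ r₂ s₁ s₂ : ℝ} (h : r₁ • S.e₁ + r₂ • S.e₂ = s₁ • S.e₁ + s₂ • S.e₂) :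
    r₁ = s₁ ∧ r₂ = s₂ := by
  have h0 := congrFun h 0
  have h1 := congrFun h 1
  simp only [Pi.add_apply, Pi.smul_apply, smul_eq_mul] at h0 h1
  constructor
  · refine mul_right_cancel₀ S.det_ne_zero ?_
    linear_combination S.e₂ 1 * h0 - S.e₂ 0 * h1
  · refine mul_right_cancel₀ S.det_ne_zero ?_
    linear_combination S.e₁ 0 * h1 - S.e₁ 1 * h0

/-- Comparing coefficients of e₁ and e₂ separates the system: the first equation is a round sphere
in the first group of variables, the second a sphere in the other group whose radius depends on the
first. -/
theorem mem_R_iff (u : Fin m → ℝ) : u ∈ Q.R ↔ ∑ i, u (S.σ (Sum.inl i)) ^ 2 = S.c₁ ∧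
    ∑ j, u (S.σ (Sum.inr j)) ^ 2 = S.c₂ - ∑ i, S.a i * u (S.σ (Sum.inl i)) ^ 2 := by
  have h : ∑ k, u k ^ 2 • Q.γ k = (∑ i, u (S.σ (Sum.inl i)) ^ 2) • S.e₁ +
      (∑ i, S.a i * u (S.σ (Sum.inl i)) ^ 2 + ∑ j, u (S.σ (Sum.inr j)) ^ 2) • S.e₂ := by
    rw [← S.σ.sum_comp, Fintype.sum_sum_type]
    simp only [S.γ_inl, S.γ_inr, smul_add, Finset.sum_add_distrib, ← Finset.sum_smul, smul_smul,
      add_smul, add_assoc]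
    simp only [mul_comm]
  change ∑ k, u k ^ 2 • Q.γ k = Q.c ↔ _
  rw [h, S.c_eq]
  constructor
  · intro h
    obtain ⟨h1, h2⟩ := S.coords_unique h
    exact ⟨h1, by linarith⟩
  · rintro ⟨h1, h2⟩
    rw [h1, h2]
    congr 2
    ring

/-- The sum is an average of the numbers aᵢc₁, each below c₂, with weights wᵢ/c₁. It is what makes
the second radius positive, so that R_Γ is a product of spheres. -/
theorem sum_lt_c₂ {w : Fin p → ℝ} (hw : ∀ i, 0 ≤ w i) (h : ∑ i, w i = S.c₁) :
    ∑ i, S.a i * w i < S.c₂ := by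
  have hpos := S.c₁_pos
  obtain ⟨i, hi⟩ : ∃ i, 0 < w i := by
    by_contra! hcon
    have := Finset.sum_nonpos fun i (_ : i ∈ Finset.univ) => hcon i
    linarith
  have h1 : ∑ i, (S.a i * S.c₁) * w i < ∑ i, S.c₂ * w i :=
    Finset.sum_lt_sum (fun i _ => mul_le_mul_of_nonneg_right (S.lt_c₂ i).le (hw i))
      ⟨i, Finset.mem_univ _, mul_lt_mul_of_pos_right (S.lt_c₂ i) hi⟩
  rw [← Finset.mul_sum, h] at h1
  have h2 : ∑ i, (S.a i * S.c₁) * w i = S.c₁ * ∑ i, S.a i * w i := by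
    rw [Finset.mul_sum]; exact Finset.sum_congr rfl fun i _ => by ring
  rw [h2, mul_comm S.c₂] at h1
  exact lt_of_mul_lt_mul_left h1 hpos.le

/-- The parameters are s = exp(2πi⟨e₁, φ⟩) and t = exp(2πi⟨e₂, φ⟩); independence of e₁ and e₂ lets
them take any two values on the circle. -/
theorem mem_T_iff (z : Fin m → ℂ) : z ∈ Q.T ↔ ∃ s t : Circle,
    (∀ i, z (S.σ (Sum.inl i)) = s * (t : ℂ) ^ S.a i) ∧ ∀ j, z (S.σ (Sum.inr j)) = t := by
  have key : ∀ (φ : Fin 2 → ℝ) (s t : ℂ),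
      s = Complex.exp (2 * Real.pi * Complex.I * ((S.e₁ ⬝ᵥ φ : ℝ) : ℂ)) →
      t = Complex.exp (2 * Real.pi * Complex.I * ((S.e₂ ⬝ᵥ φ : ℝ) : ℂ)) →
      (∀ i, Q.torusPoint φ (S.σ (Sum.inl i)) = s * t ^ S.a i) ∧
        ∀ j, Q.torusPoint φ (S.σ (Sum.inr j)) = t := by
    rintro φ s t rfl rfl
    refine ⟨fun i => ?_, fun j => ?_⟩
    · rw [torusPoint, S.γ_inl, add_dotProduct, smul_dotProduct, ← Complex.exp_int_mul,
        ← Complex.exp_add]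
      congr 1
      push_cast [smul_eq_mul]
      ring
    · rw [torusPoint, S.γ_inr]
  constructor
  · rintro ⟨φ, rfl⟩
    have hn : ∀ r : ℝ, ‖Complex.exp (2 * Real.pi * Complex.I * (r : ℂ))‖ = 1 := fun r => by
      simp [Complex.norm_exp]
    exact ⟨⟨_, mem_sphere_zero_iff_norm.2 (hn (S.e₁ ⬝ᵥ φ))⟩,
      ⟨_, mem_sphere_zero_iff_norm.2 (hn (S.e₂ ⬝ᵥ φ))⟩, key φ _ _ rfl rfl⟩
  · rintro ⟨s, t, hs, ht⟩
    obtain ⟨θ₁, h1⟩ := s.exists_exp_two_pi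
    obtain ⟨θ₂, h2⟩ := t.exists_exp_two_pi
    obtain ⟨φ, hφ1, hφ2⟩ := S.exists_dotProduct θ₁ θ₂
    obtain ⟨h3, h4⟩ := key φ s t (by rw [h1, hφ1]) (by rw [h2, hφ2])
    refine ⟨φ, funext fun k => ?_⟩
    obtain ⟨k, rfl⟩ := S.σ.surjective k
    rcases k with i | j
    · rw [h3, hs]
    · rw [h4, ht]

/-- If all coordinates s·t^{aᵢ} and t are signs, then so are t, read off at `j₀`, and s, read off at
`i₀` after dividing by a power of t. -/
theorem mem_D_iff (ε : Fin m → ℤˣ) : ε ∈ Q.D ↔ ∃ τ₁ τ₂ : ℤˣ,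
    (∀ i, ε (S.σ (Sum.inl i)) = τ₁ * τ₂ ^ S.a i) ∧ ∀ j, ε (S.σ (Sum.inr j)) = τ₂ := by
  rw [Q.mem_D_iff, S.mem_T_iff]
  have hinj : ∀ {a b : ℤˣ}, ((a : ℤ) : ℂ) = ((b : ℤ) : ℂ) → a = b := fun h =>
    Units.ext (by exact_mod_cast h)
  constructor
  · rintro ⟨s, t, hs, ht⟩
    have h2 : ((ε (S.σ (Sum.inr S.j₀)) : ℤ) : ℂ) = t := ht S.j₀
    refine ⟨ε (S.σ (Sum.inl S.i₀)) * (ε (S.σ (Sum.inr S.j₀))) ^ (-S.a S.i₀),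
      ε (S.σ (Sum.inr S.j₀)), fun i => hinj ?_, fun j => hinj ?_⟩
    · have ht0 : (t : ℂ) ≠ 0 := t.coe_ne_zero
      push_cast [coe_units_zpow]
      rw [hs, hs, h2, zpow_neg, mul_assoc (s : ℂ),
        mul_inv_cancel₀ (zpow_ne_zero _ ht0), mul_one]
    · rw [ht, h2]
  · rintro ⟨τ₁, τ₂, h1, h2⟩
    have h3 : ∀ τ : ℤˣ, ((ModelCover.circleSign τ 1 : Circle) : ℂ) = ((τ : ℤ) : ℂ) := fun τ => by
      change ((τ : ℤ) : ℂ) * ((1 : Circle) : ℂ) = _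
      simp
    refine ⟨ModelCover.circleSign τ₁ 1, ModelCover.circleSign τ₂ 1, fun i => ?_, fun j => ?_⟩
    · rw [h1, h3, h3]; push_cast [coe_units_zpow]; rfl
    · rw [h2, h3]

end QuadricData.NormalForm

/-! ### The diffeomorphism of N_Γ with the model -/

theorem ModelCover.exists_incl_eq {k p q : ℕ}
    (z : EuclideanSpace ℝ (Fin p) × EuclideanSpace ℝ (Fin q) × ℂ × ℂ)
    (h1 : ∑ i, z.1 i ^ 2 = 1) (h2 : ∑ i, z.2.1 i ^ 2 = 1) (h3 : ‖z.2.2.1‖ = 1)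
    (h4 : ‖z.2.2.2‖ = 1) : ∃ y : ModelCover k p q, ModelCover.incl k p q y = z := by
  have hn : ∀ {n : ℕ} (x : EuclideanSpace ℝ (Fin n)), ∑ i, x i ^ 2 = 1 → ‖x‖ = 1 := by
    intro n x hx
    rw [EuclideanSpace.norm_eq]
    simp [hx]
  exact ⟨(⟨z.1, mem_sphere_zero_iff_norm.2 (hn _ h1)⟩, ⟨z.2.1, mem_sphere_zero_iff_norm.2 (hn _ h2)⟩,
    ⟨z.2.2.1, mem_sphere_zero_iff_norm.2 h3⟩, ⟨z.2.2.2, mem_sphere_zero_iff_norm.2 h4⟩), rfl⟩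

theorem sum_sq_sphere {n : ℕ} (x : Metric.sphere (0 : EuclideanSpace ℝ (Fin n)) 1) :
    ∑ i, x.1 i ^ 2 = 1 := by
  have h := mem_sphere_zero_iff_norm.1 x.2
  rw [EuclideanSpace.norm_eq, Real.sqrt_eq_one] at h
  simpa using h

namespace QuadricData.NormalForm

variable {m p q : ℕ} {Q : QuadricData m 2} (S : Q.NormalForm p q)

/-- The map `R_Γ × T_Γ → S^{p-1} × S^{q-1} × S¹ × S¹` on the ambient spaces. -/
def toModel (z : (Fin m → ℝ) × (Fin m → ℂ)) :
    EuclideanSpace ℝ (Fin p) × EuclideanSpace ℝ (Fin q) × ℂ × ℂ :=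
  (WithLp.toLp 2 fun i => z.1 (S.σ (Sum.inl i)) / √S.c₁,
    WithLp.toLp 2 fun j => z.1 (S.σ (Sum.inr j)) /
      √(S.c₂ - ∑ i, S.a i * z.1 (S.σ (Sum.inl i)) ^ 2),
    -- The coordinate at `i₀` is s·t^{a}, so multiplying by t^{-a} isolates s.
    z.2 (S.σ (Sum.inl S.i₀)) * unitPow (-S.a S.i₀) (z.2 (S.σ (Sum.inr S.j₀))),
    z.2 (S.σ (Sum.inr S.j₀)))

/-- The map `S^{p-1} × S^{q-1} × S¹ × S¹ → R_Γ × T_Γ` on the ambient spaces. -/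
def ofModel (y : EuclideanSpace ℝ (Fin p) × EuclideanSpace ℝ (Fin q) × ℂ × ℂ) :
    (Fin m → ℝ) × (Fin m → ℂ) :=
  (fun l => Sum.elim (fun i => √S.c₁ * y.1 i)
      (fun j => √(S.c₂ - S.c₁ * ∑ i, S.a i * y.1 i ^ 2) * y.2.1 j) (S.σ.symm l),
    fun l => Sum.elim (fun i => y.2.2.1 * unitPow (S.a i) y.2.2.2) (fun _ => y.2.2.2) (S.σ.symm l))

theorem sub_sum_pos (u : Q.R) : 0 < S.c₂ - ∑ i, S.a i * u.1 (S.σ (Sum.inl i)) ^ 2 :=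
  sub_pos.2 (S.sum_lt_c₂ (fun _ => sq_nonneg _) ((S.mem_R_iff _).1 u.2).1)

theorem sub_mul_sum_pos {x : EuclideanSpace ℝ (Fin p)} (hx : ∑ i, x i ^ 2 = 1) :
    0 < S.c₂ - S.c₁ * ∑ i, S.a i * x i ^ 2 := by
  have := S.sum_lt_c₂ (w := fun i => S.c₁ * x i ^ 2)
    (fun i => mul_nonneg S.c₁_pos.le (sq_nonneg _)) (by rw [← Finset.mul_sum, hx, mul_one])
  rw [Finset.mul_sum, sub_pos]
  exact lt_of_eq_of_lt (Finset.sum_congr rfl fun i _ => by ring) this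

theorem exists_toModel (k : ℕ) (x : Q.R × Q.T) :
    ∃ y : ModelCover k p q, ModelCover.incl k p q y = S.toModel (Q.incl x) := by
  obtain ⟨u, z, hz⟩ := x
  obtain ⟨h1, h2⟩ := (S.mem_R_iff _).1 u.2
  obtain ⟨s, t, hs, ht⟩ := (S.mem_T_iff _).1 hz
  refine ModelCover.exists_incl_eq _ ?_ ?_ ?_ ?_
  · simp only [toModel, incl, div_pow, Real.sq_sqrt S.c₁_pos.le, ← Finset.sum_div]
    rw [h1, div_self S.c₁_pos.ne']
  · simp only [toModel, incl, div_pow, Real.sq_sqrt (S.sub_sum_pos u).le, ← Finset.sum_div]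
    rw [h2, div_self (S.sub_sum_pos u).ne']
  · simp [toModel, incl, hs, ht, unitPow_coe_circle, Circle.norm_coe]
  · simp [toModel, incl, ht, Circle.norm_coe]

theorem exists_ofModel {k : ℕ} (y : ModelCover k p q) :
    ∃ x : Q.R × Q.T, Q.incl x = S.ofModel (ModelCover.incl k p q y) := by
  have h1 := sum_sq_sphere y.1
  have h2 := sum_sq_sphere y.2.1
  refine ⟨(⟨(S.ofModel (ModelCover.incl k p q y)).1, ?_⟩,
    ⟨(S.ofModel (ModelCover.incl k p q y)).2, ?_⟩), rfl⟩
  · refine (S.mem_R_iff _).2 ⟨?_, ?_⟩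
    · simp only [ofModel, ModelCover.incl, Equiv.symm_apply_apply, Sum.elim_inl, mul_pow,
        Real.sq_sqrt S.c₁_pos.le, ← Finset.mul_sum, h1, mul_one]
    · simp only [ofModel, ModelCover.incl, Equiv.symm_apply_apply, Sum.elim_inl, Sum.elim_inr,
        mul_pow, Real.sq_sqrt S.c₁_pos.le, Real.sq_sqrt (S.sub_mul_sum_pos h1).le,
        ← Finset.mul_sum, h2, mul_one]
      rw [Finset.mul_sum]
      congr 1
      exact Finset.sum_congr rfl fun i _ => by ring
  · refine (S.mem_T_iff _).2 ⟨y.2.2.1, y.2.2.2, fun i => ?_, fun j => ?_⟩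
    · simp [ofModel, ModelCover.incl, unitPow_coe_circle]
    · simp [ofModel, ModelCover.incl]

theorem ofModel_toModel (x : Q.R × Q.T) : S.ofModel (S.toModel (Q.incl x)) = Q.incl x := by
  obtain ⟨u, z, hz⟩ := x
  obtain ⟨s, t, hs, ht⟩ := (S.mem_T_iff _).1 hz
  have h0 := S.c₁_pos
  have h3 := S.sub_sum_pos u
  have ht0 : (t : ℂ) ≠ 0 := t.coe_ne_zero
  have hsum : S.c₁ * ∑ i, S.a i * (u.1 (S.σ (Sum.inl i)) / √S.c₁) ^ 2 =
      ∑ i, S.a i * u.1 (S.σ (Sum.inl i)) ^ 2 := by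
    rw [Finset.mul_sum]
    refine Finset.sum_congr rfl fun i _ => ?_
    rw [div_pow, Real.sq_sqrt h0.le]
    field_simp
  refine Prod.ext (funext fun l => ?_) (funext fun l => ?_) <;>
  · obtain ⟨l, rfl⟩ := S.σ.surjective l
    rcases l with i | j
    · simp only [ofModel, toModel, incl, Equiv.symm_apply_apply, Sum.elim_inl, hs, ht,
        unitPow_coe_circle, zpow_neg]
      first
      | rw [inv_mul_cancel_right₀ (zpow_ne_zero _ ht0)]
      | field_simp
    · simp only [ofModel, toModel, incl, Equiv.symm_apply_apply, Sum.elim_inr]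
      first
      | rw [hsum, mul_div_cancel₀ _ (Real.sqrt_pos.2 h3).ne']
      | rw [ht, ht]

theorem toModel_ofModel {k : ℕ} (y : ModelCover k p q) :
    S.toModel (S.ofModel (ModelCover.incl k p q y)) = ModelCover.incl k p q y := by
  have h0 := S.c₁_pos
  have h1 := S.sub_mul_sum_pos (sum_sq_sphere y.1)
  have ht0 : (y.2.2.2 : ℂ) ≠ 0 := y.2.2.2.coe_ne_zero
  have hsum : ∑ i, S.a i * (√S.c₁ * y.1.1 i) ^ 2 = S.c₁ * ∑ i, S.a i * y.1.1 i ^ 2 := by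
    rw [Finset.mul_sum]
    refine Finset.sum_congr rfl fun i _ => ?_
    rw [mul_pow, Real.sq_sqrt h0.le]
    ring
  refine Prod.ext (PiLp.ext fun i => ?_) (Prod.ext (PiLp.ext fun j => ?_) (Prod.ext ?_ ?_))
  · simp only [ofModel, toModel, ModelCover.incl, Equiv.symm_apply_apply, Sum.elim_inl]
    exact mul_div_cancel_left₀ _ (Real.sqrt_pos.2 h0).ne'
  · simp only [ofModel, toModel, ModelCover.incl, Equiv.symm_apply_apply, Sum.elim_inr,
      Sum.elim_inl]
    rw [hsum]
    exact mul_div_cancel_left₀ _ (Real.sqrt_pos.2 h1).ne'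
  · simp only [ofModel, toModel, ModelCover.incl, Equiv.symm_apply_apply, Sum.elim_inr,
      Sum.elim_inl, unitPow_coe_circle, zpow_neg]
    exact mul_inv_cancel_right₀ (zpow_ne_zero _ ht0) _
  · simp only [ofModel, toModel, ModelCover.incl, Equiv.symm_apply_apply, Sum.elim_inr]

theorem ambientSmooth_toModel (k : ℕ) (f : Q.R × Q.T → ModelCover k p q)
    (hf : ∀ x, ModelCover.incl k p q (f x) = S.toModel (Q.incl x)) :
    AmbientSmooth Q.incl (ModelCover.incl k p q) f := by
  intro x
  have hρ : ContDiff ℝ ∞ fun z : (Fin m → ℝ) × (Fin m → ℂ) =>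
    S.c₂ - ∑ i, S.a i * z.1 (S.σ (Sum.inl i)) ^ 2 := by fun_prop
  -- The normalising square root is smooth only where the squared radius is positive; this open set
  -- contains the image of every point of R_Γ × T_Γ.
  refine ⟨{z | 0 < S.c₂ - ∑ i, S.a i * z.1 (S.σ (Sum.inl i)) ^ 2}, S.toModel,
    isOpen_lt continuous_const hρ.continuous, S.sub_sum_pos x.1, ?_, fun y _ => hf y⟩
  refine ContDiffOn.prodMk ?_ (ContDiffOn.prodMk ?_ (ContDiffOn.prodMk ?_ ?_))
  · exact ContDiff.contDiffOn (by fun_prop)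
  · rw [contDiffOn_piLp]
    intro j
    have h1 : ContDiff ℝ ∞ fun z : (Fin m → ℝ) × (Fin m → ℂ) => z.1 (S.σ (Sum.inr j)) := by
      fun_prop
    exact h1.contDiffOn.div (hρ.contDiffOn.sqrt fun z hz => ne_of_gt hz)
      fun z hz => (Real.sqrt_pos.2 hz).ne'
  · have h1 := contDiff_unitPow (-S.a S.i₀)
    exact ContDiff.contDiffOn (by fun_prop)
  · exact ContDiff.contDiffOn (by fun_prop)

theorem ambientSmooth_ofModel {k : ℕ} (f : ModelCover k p q → Q.R × Q.T)
    (hf : ∀ y, Q.incl (f y) = S.ofModel (ModelCover.incl k p q y)) :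
    AmbientSmooth (ModelCover.incl k p q) Q.incl f := by
  intro y
  have hρ : ContDiff ℝ ∞ fun y : EuclideanSpace ℝ (Fin p) × EuclideanSpace ℝ (Fin q) × ℂ × ℂ =>
    S.c₂ - S.c₁ * ∑ i, S.a i * y.1 i ^ 2 := by fun_prop
  refine ⟨{y | 0 < S.c₂ - S.c₁ * ∑ i, S.a i * y.1 i ^ 2}, S.ofModel,
    isOpen_lt continuous_const hρ.continuous, S.sub_mul_sum_pos (sum_sq_sphere y.1), ?_,
    fun y _ => hf y⟩
  refine ContDiffOn.prodMk (contDiffOn_pi.2 fun l => ?_) (contDiffOn_pi.2 fun l => ?_)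
  · rcases S.σ.symm l with i | j
    · exact ContDiff.contDiffOn (by simp only [Sum.elim_inl]; fun_prop)
    · have h1 : ContDiff ℝ ∞ fun y : EuclideanSpace ℝ (Fin p) × EuclideanSpace ℝ (Fin q) × ℂ × ℂ =>
        y.2.1 j := by fun_prop
      exact (hρ.contDiffOn.sqrt fun z hz => ne_of_gt hz).mul h1.contDiffOn
  · rcases S.σ.symm l with i | j
    · have h1 := contDiff_unitPow (S.a i)
      exact ContDiff.contDiffOn (by simp only [Sum.elim_inl]; fun_prop)
    · exact ContDiff.contDiffOn (by simp only [Sum.elim_inr]; fun_prop)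

/-- The rescaling is equivariant when (τ₁, τ₂) corresponds to the sign vector with entries τ₁τ₂^{aᵢ}
and τ₂. By `hk` the exponent is odd exactly on the first `k` coordinates, where the model action has
the extra factor τ₂. -/
theorem nonempty_diffeomorph {k : ℕ} (hk : ∀ i : Fin p, (i : ℕ) < k ↔ Odd (S.a i)) :
    Nonempty (Q.N ≃ₘ⟮𝓘(ℝ, EuclideanSpace ℝ (Fin m)), 𝓘(ℝ, EuclideanSpace ℝ (Fin (p + q)))⟯
      Nkpq k p q) := by
  choose f hf using S.exists_toModel k
  choose g hg using S.exists_ofModel (k := k)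
  let F : Q.R × Q.T ≃ ModelCover k p q :=
    { toFun := f
      invFun := g
      left_inv := fun x => Q.isEmbedding_incl.injective (by rw [hg, hf, S.ofModel_toModel])
      right_inv := fun y => (ModelCover.isEmbedding_incl k p q).injective
        (by rw [hf, hg, S.toModel_ofModel]) }
  have hact : ∀ (ε : Q.D) (τ₁ τ₂ : ℤˣ), (∀ i, ε.1 (S.σ (Sum.inl i)) = τ₁ * τ₂ ^ S.a i) →
      (∀ j, ε.1 (S.σ (Sum.inr j)) = τ₂) →
      ∀ y : ModelCover k p q, g ((τ₁, τ₂) • y) = ε • g y := by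
    intro ε τ₁ τ₂ h1 h2 y
    refine Q.isEmbedding_incl.injective ?_
    have h3 : Q.incl (ε • g y) = (fun l => ((ε.1 l : ℤ) : ℝ) * (Q.incl (g y)).1 l,
      fun l => ((ε.1 l : ℤ) : ℂ) * (Q.incl (g y)).2 l) := rfl
    have hx : ∀ i, ((τ₁, τ₂) • y).1.1 i = (((τ₁ * τ₂ ^ S.a i : ℤˣ) : ℤ) : ℝ) * y.1.1 i := by
      intro i
      change (((if (i : ℕ) < k then τ₁ * τ₂ else τ₁ : ℤˣ) : ℤ) : ℝ) * y.1.1 i = _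
      rw [intUnits_zpow_eq_ite]
      simp only [hk, mul_ite, mul_one]
    have hy : ∀ j, ((τ₁, τ₂) • y).2.1.1 j = ((τ₂ : ℤ) : ℝ) * y.2.1.1 j := fun j => rfl
    have hs : (((τ₁, τ₂) • y).2.2.1 : ℂ) = ((τ₁ : ℤ) : ℂ) * y.2.2.1 := rfl
    have ht : (((τ₁, τ₂) • y).2.2.2 : ℂ) = ((τ₂ : ℤ) : ℂ) * y.2.2.2 := rfl
    -- The radius of the second sphere depends only on these squares, hence is unchanged by the
    -- action.
    have hxx : ∀ i, (((τ₁, τ₂) • y).1.1 i) ^ 2 = y.1.1 i ^ 2 := by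
      intro i
      rw [hx]
      rcases Int.units_eq_one_or (τ₁ * τ₂ ^ S.a i) with h | h <;> simp [h]
    rw [h3, hg, hg]
    refine Prod.ext (funext fun l => ?_) (funext fun l => ?_) <;>
      obtain ⟨l, rfl⟩ := S.σ.surjective l
    · rcases l with i | j
      · simp only [ofModel, ModelCover.incl, Equiv.symm_apply_apply, Sum.elim_inl, hx, h1]
        ring
      · simp only [ofModel, ModelCover.incl, Equiv.symm_apply_apply, Sum.elim_inr, hxx, hy, h2]
        ring
    · rcases l with i | j
      · simp only [ofModel, ModelCover.incl, Equiv.symm_apply_apply, Sum.elim_inl,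
          unitPow_coe_circle]
        rw [hs, ht, h1, mul_zpow]
        push_cast [coe_units_zpow]
        ring
      · simp only [ofModel, ModelCover.incl, Equiv.symm_apply_apply, Sum.elim_inr, ht, h2]
  have hrel : ∀ y y', Nkpq.proj k p q y = Nkpq.proj k p q y' ↔ Q.proj (g y) = Q.proj (g y') := by
    intro y y'
    rw [Nkpq.proj_eq_iff, Q.proj_eq_iff]
    constructor
    · rintro ⟨⟨τ₁, τ₂⟩, rfl⟩
      let ε : Fin m → ℤˣ := fun l =>
        Sum.elim (fun i => τ₁ * τ₂ ^ S.a i) (fun _ => τ₂) (S.σ.symm l)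
      have h1 : ∀ i, ε (S.σ (Sum.inl i)) = τ₁ * τ₂ ^ S.a i := fun i => by simp [ε]
      have h2 : ∀ j, ε (S.σ (Sum.inr j)) = τ₂ := fun j => by simp [ε]
      exact ⟨⟨ε, (S.mem_D_iff ε).2 ⟨τ₁, τ₂, h1, h2⟩⟩, (hact _ τ₁ τ₂ h1 h2 y').symm⟩
    · rintro ⟨ε, hε⟩
      obtain ⟨τ₁, τ₂, h1, h2⟩ := (S.mem_D_iff _).1 ε.2
      rw [← hact ε τ₁ τ₂ h1 h2] at hε
      exact ⟨(τ₁, τ₂), F.symm.injective hε⟩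
  exact nonempty_diffeomorph_of_ambientSmooth Q.exists_chart (Nkpq.exists_chart k p q)
    Q.isEmbedding_incl.isInducing (ModelCover.isEmbedding_incl k p q).isInducing
    Q.isQuotientMap_proj (Nkpq.isQuotientMap_proj k p q) F (S.ambientSmooth_toModel k f hf)
    (S.ambientSmooth_ofModel g hg) fun x x' => by
      rw [hrel]
      change _ ↔ Q.proj (F.symm (F x)) = Q.proj (F.symm (F x'))
      rw [F.symm_apply_apply, F.symm_apply_apply]

end QuadricData.NormalForm

/-! ### The map i_Γ is an embedding for a normal form -/

theorem exists_sign_mul_pos {r : ℝ} (hr : r ≠ 0) : ∃ δ : ℝ, |δ| = 1 ∧ 0 < δ * r := by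
  rcases lt_or_gt_of_ne hr with h | h
  · exact ⟨-1, by simp, by linarith⟩
  · exact ⟨1, by simp, by linarith⟩

namespace QuadricData

variable {m d : ℕ} (Q : QuadricData m d)

theorem continuous_immersion : Continuous Q.immersion := by
  refine Q.isQuotientMap_proj.continuous_iff.2 (continuous_pi fun l => ?_)
  have h1 : Continuous fun x : Q.R × Q.T => x.1.1 l :=
    (continuous_apply l).comp (continuous_subtype_val.comp continuous_fst)
  have h2 : Continuous fun x : Q.R × Q.T => x.2.1 l :=
    (continuous_apply l).comp (continuous_subtype_val.comp continuous_snd)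
  exact (Complex.continuous_ofReal.comp h1).mul h2

theorem norm_T_apply (z : Q.T) (l : Fin m) : ‖z.1 l‖ = 1 := by
  obtain ⟨φ, hφ⟩ := z.2
  rw [← hφ, norm_torusPoint]

end QuadricData

namespace QuadricData.NormalForm

variable {m p q : ℕ} {Q : QuadricData m 2} (S : Q.NormalForm p q)

/-- The point of `T_Γ` with parameters `s` and `t`. -/
def torusParam (s t : ℂ) : Fin m → ℂ := fun l =>
  Sum.elim (fun i => s * unitPow (S.a i) t) (fun _ => t) (S.σ.symm l)

/-- The point `(u, z)` with image `w` under `(u, z) ↦ (u₁z₁, …, uₘzₘ)` such that `u` has prescribed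
signs at the indices `i` and `j`. -/
def recover (i : Fin p) (j : Fin q) (δ₁ δ₂ : ℝ) (w : Fin m → ℂ) : (Fin m → ℝ) × (Fin m → ℂ) :=
  -- The phase w/‖w‖ of a nonzero coordinate w = uz, with u real and ‖z‖ = 1, is z up to the sign of
  -- u, which δ corrects. Two such phases give t and s, hence all of z, and then each u is the real
  -- part of w times the conjugate of z.
  let t : ℂ := (δ₂ / ‖w (S.σ (Sum.inr j))‖ : ℝ) * w (S.σ (Sum.inr j))
  let s : ℂ := (δ₁ / ‖w (S.σ (Sum.inl i))‖ : ℝ) * w (S.σ (Sum.inl i)) * unitPow (-S.a i) t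
  (fun l => (w l * starRingEnd ℂ (S.torusParam s t l)).re, S.torusParam s t)

theorem recover_immersion (x : Q.R × Q.T) {i : Fin p} {j : Fin q} {δ₁ δ₂ : ℝ}
    (h1 : 0 < δ₁ * x.1.1 (S.σ (Sum.inl i))) (h2 : 0 < δ₂ * x.1.1 (S.σ (Sum.inr j)))
    (h1' : |δ₁| = 1) (h2' : |δ₂| = 1) :
    S.recover i j δ₁ δ₂ (fun l => (x.1.1 l : ℂ) * x.2.1 l) = Q.incl x := by
  obtain ⟨u, z⟩ := x
  obtain ⟨s, t, hs, ht⟩ := (S.mem_T_iff _).1 z.2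
  have ht0 : (t : ℂ) ≠ 0 := t.coe_ne_zero
  have key : ∀ (δ r : ℝ) (c : ℂ), ‖c‖ = 1 → |δ| = 1 → 0 < δ * r →
      ((δ / ‖(r : ℂ) * c‖ : ℝ) : ℂ) * ((r : ℂ) * c) = c := by
    intro δ r c hc hδ h
    have h3 : |r| = δ * r := by rw [← abs_of_pos h, abs_mul, hδ, one_mul]
    have h4 : r ≠ 0 := by rintro rfl; simp at h
    rw [norm_mul, hc, mul_one, Complex.norm_real, Real.norm_eq_abs, h3, ← mul_assoc,
      ← Complex.ofReal_mul]
    have h5 : δ / (δ * r) * r = 1 := by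
      rw [div_mul_eq_mul_div, div_self h.ne']
    rw [h5, Complex.ofReal_one, one_mul]
  have hz : S.torusParam s t = z.1 := by
    funext l
    obtain ⟨l, rfl⟩ := S.σ.surjective l
    rcases l with i | j
    · simp [torusParam, hs, unitPow_coe_circle]
    · simp [torusParam, ht]
  have e2 := key δ₂ _ _ (Q.norm_T_apply z (S.σ (Sum.inr j))) h2' h2
  have e1 := key δ₁ _ _ (Q.norm_T_apply z (S.σ (Sum.inl i))) h1' h1
  have e3 : z.1 (S.σ (Sum.inl i)) * unitPow (-S.a i) (z.1 (S.σ (Sum.inr j))) = s := by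
    rw [hs, ht, unitPow_coe_circle, zpow_neg, mul_inv_cancel_right₀ (zpow_ne_zero _ ht0)]
  simp only [recover]
  rw [e1, e2, e3, ht, hz]
  refine Prod.ext (funext fun l => ?_) rfl
  have h6 : z.1 l * starRingEnd ℂ (z.1 l) = 1 := by
    rw [Complex.mul_conj, Complex.normSq_eq_norm_sq, Q.norm_T_apply]; simp
  simp only [incl]
  rw [mul_assoc, h6, mul_one, Complex.ofReal_re]

theorem contDiffAt_recover {i : Fin p} {j : Fin q} (δ₁ δ₂ : ℝ) {w : Fin m → ℂ}
    (h1 : w (S.σ (Sum.inl i)) ≠ 0) (h2 : w (S.σ (Sum.inr j)) ≠ 0) :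
    ContDiffAt ℝ ∞ (S.recover i j δ₁ δ₂) w := by
  have hw : ∀ l, ContDiffAt ℝ ∞ (fun w : Fin m → ℂ => w l) w := fun l => by fun_prop
  have hphase : ∀ (δ : ℝ) l, w l ≠ 0 →
      ContDiffAt ℝ ∞ (fun w : Fin m → ℂ => ((δ / ‖w l‖ : ℝ) : ℂ) * w l) w := by
    intro δ l hl
    have h3 : ContDiffAt ℝ ∞ (fun w : Fin m → ℂ => ‖w l‖) w := (hw l).norm ℝ hl
    have h4 : ContDiffAt ℝ ∞ (fun w : Fin m → ℂ => δ / ‖w l‖) w :=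
      contDiffAt_const.div h3 (norm_ne_zero_iff.2 hl)
    exact (Complex.ofRealCLM.contDiff.contDiffAt.comp w h4).mul (hw l)
  have ht := hphase δ₂ _ h2
  have hpow : ∀ n, ContDiffAt ℝ ∞ (fun w : Fin m → ℂ =>
      unitPow n ((δ₂ / ‖w (S.σ (Sum.inr j))‖ : ℝ) * w (S.σ (Sum.inr j)))) w := fun n =>
    (contDiff_unitPow n).contDiffAt.comp w ht
  have hs := (hphase δ₁ _ h1).mul (hpow (-S.a i))
  have hT : ∀ l, ContDiffAt ℝ ∞ (fun w => (S.recover i j δ₁ δ₂ w).2 l) w := by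
    intro l
    simp only [recover, torusParam]
    rcases S.σ.symm l with l | l
    · exact hs.mul (hpow (S.a l))
    · exact ht
  refine ContDiffAt.prodMk (contDiffAt_pi.2 fun l => ?_) (contDiffAt_pi.2 hT)
  exact Complex.reCLM.contDiff.contDiffAt.comp w
    ((hw l).mul (Complex.conjCLE.contDiff.contDiffAt.comp w (hT l)))

/-- Both spheres have positive radius, so each group of variables contains a nonzero one; hence some
`recover` applies at every point. -/
theorem exists_ne_zero (u : Q.R) : (∃ i, u.1 (S.σ (Sum.inl i)) ≠ 0) ∧
    ∃ j, u.1 (S.σ (Sum.inr j)) ≠ 0 := by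
  obtain ⟨h1, h2⟩ := (S.mem_R_iff _).1 u.2
  constructor <;> by_contra! hcon
  · simp only [hcon] at h1
    have := S.c₁_pos
    simp at h1
    linarith
  · have := S.sub_sum_pos u
    rw [← h2] at this
    simp [hcon] at this

/-- Equal images have coordinates u with equal absolute values. An element of D_Γ matches their
signs at one nonzero coordinate of each group, and then one and the same map `recover` returns both
points from the common image. -/
theorem injective_immersion (S : Q.NormalForm p q) : Function.Injective Q.immersion := by
  intro n n' h
  obtain ⟨x, rfl⟩ := Q.proj_surjective n
  obtain ⟨x', rfl⟩ := Q.proj_surjective n'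
  obtain ⟨⟨i, hi⟩, j, hj⟩ := S.exists_ne_zero x.1
  rw [Q.immersion_proj, Q.immersion_proj] at h
  have habs : ∀ l, ∃ τ : ℤˣ, ((τ : ℤ) : ℝ) * x'.1.1 l = x.1.1 l := by
    intro l
    have h1 := congrArg norm (congrFun h l)
    simp only [norm_mul, Q.norm_T_apply, mul_one, Complex.norm_real, Real.norm_eq_abs] at h1
    rcases abs_eq_abs.1 h1 with h2 | h2
    · exact ⟨1, by simp [h2]⟩
    · exact ⟨-1, by simp [h2]⟩
  obtain ⟨τ, hτ⟩ := habs (S.σ (Sum.inl i))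
  obtain ⟨τ₂, hτ₂⟩ := habs (S.σ (Sum.inr j))
  -- τ₁ = τ·τ₂^{-a} is chosen so that the entry τ₁τ₂^{a} at the index `i` is τ.
  let ε : Fin m → ℤˣ := fun l =>
    Sum.elim (fun i' => (τ * τ₂ ^ (-S.a i)) * τ₂ ^ S.a i') (fun _ => τ₂) (S.σ.symm l)
  have hε : ε ∈ Q.D := (S.mem_D_iff ε).2 ⟨τ * τ₂ ^ (-S.a i), τ₂, fun i => by simp [ε],
    fun j => by simp [ε]⟩
  have e1 : ε (S.σ (Sum.inl i)) = τ := by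
    simp only [ε, Equiv.symm_apply_apply, Sum.elim_inl]
    rw [zpow_neg, inv_mul_cancel_right]
  have e2 : ε (S.σ (Sum.inr j)) = τ₂ := by simp [ε]
  let y : Q.R × Q.T := (⟨ε, hε⟩ : Q.D) • x'
  have hy1 : ∀ l, y.1.1 l = ((ε l : ℤ) : ℝ) * x'.1.1 l := fun l => rfl
  have hyx : Q.proj y = Q.proj x' := (Q.proj_eq_iff _ _).2 ⟨_, rfl⟩
  rw [← hyx]
  have hyi : y.1.1 (S.σ (Sum.inl i)) = x.1.1 (S.σ (Sum.inl i)) := by rw [hy1, e1, hτ]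
  have hyj : y.1.1 (S.σ (Sum.inr j)) = x.1.1 (S.σ (Sum.inr j)) := by rw [hy1, e2, hτ₂]
  have himg : (fun l => (x.1.1 l : ℂ) * x.2.1 l) = fun l => (y.1.1 l : ℂ) * y.2.1 l := by
    have := congrArg Q.immersion hyx
    rw [Q.immersion_proj, Q.immersion_proj] at this
    rw [h, this]
  obtain ⟨δ₁, hδ1, hδ1'⟩ := exists_sign_mul_pos hi
  obtain ⟨δ₂, hδ2, hδ2'⟩ := exists_sign_mul_pos hj
  congr 1
  refine Q.isEmbedding_incl.injective ?_
  rw [← S.recover_immersion x hδ1' hδ2' hδ1 hδ2,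
    ← S.recover_immersion y (hyi ▸ hδ1') (hyj ▸ hδ2') hδ1 hδ2, himg]

/-- The signs of the two chosen nonzero coordinates are locally constant, so near a point a single
smooth `recover` inverts i_Γ. -/
theorem isImmersion_immersion (S : Q.NormalForm p q) :
    Manifold.IsImmersion 𝓘(ℝ, EuclideanSpace ℝ (Fin m)) 𝓘(ℝ, Fin m → ℂ) ∞ Q.immersion := by
  have hG : ContDiff ℝ ∞ fun (z : (Fin m → ℝ) × (Fin m → ℂ)) (l : Fin m) => (z.1 l : ℂ) * z.2 l := by
    refine contDiff_pi.2 fun l => ?_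
    have h1 : ContDiff ℝ ∞ fun z : (Fin m → ℝ) × (Fin m → ℂ) => z.1 l := by fun_prop
    have h2 : ContDiff ℝ ∞ fun z : (Fin m → ℝ) × (Fin m → ℂ) => z.2 l := by fun_prop
    exact (Complex.ofRealCLM.contDiff.comp h1).mul h2
  refine isImmersion_of_localLeftInverse Q.exists_chart ?_ hG (fun x => rfl) fun x => ?_
  · have : Module.finrank ℝ (Fin m → ℂ) = m * 2 := by
      rw [Module.finrank_pi_fintype]; simp [Complex.finrank_real_complex]
    omega
  · obtain ⟨⟨i, hi⟩, j, hj⟩ := S.exists_ne_zero x.1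
    have hne : ∀ l, x.1.1 l ≠ 0 → (x.1.1 l : ℂ) * x.2.1 l ≠ 0 := fun l hl =>
      mul_ne_zero (Complex.ofReal_ne_zero.2 hl)
        (norm_ne_zero_iff.1 (by rw [Q.norm_T_apply]; exact one_ne_zero))
    obtain ⟨δ₁, hδ1, hδ1'⟩ := exists_sign_mul_pos hi
    obtain ⟨δ₂, hδ2, hδ2'⟩ := exists_sign_mul_pos hj
    refine ⟨S.recover i j δ₁ δ₂, S.contDiffAt_recover δ₁ δ₂ (hne _ hi) (hne _ hj), ?_⟩
    have hc : ∀ (δ : ℝ) (l : Fin m), 0 < δ * x.1.1 l →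
        ∀ᶠ z : (Fin m → ℝ) × (Fin m → ℂ) in 𝓝 (Q.incl x), 0 < δ * z.1 l := by
      intro δ l h
      have h1 : Continuous fun z : (Fin m → ℝ) × (Fin m → ℂ) => δ * z.1 l := by fun_prop
      exact h1.continuousAt.eventually (lt_mem_nhds h)
    filter_upwards [hc δ₁ _ hδ1', hc δ₂ _ hδ2'] with z h1 h2
    rintro y rfl
    exact S.recover_immersion y h1 h2 hδ1 hδ2

theorem isSmoothEmbedding_immersion (S : Q.NormalForm p q) [CompactSpace Q.N] :
    Manifold.IsSmoothEmbedding 𝓘(ℝ, EuclideanSpace ℝ (Fin m)) 𝓘(ℝ, Fin m → ℂ) ∞ Q.immersion :=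
  ⟨S.isImmersion_immersion,
    (Q.continuous_immersion.isClosedEmbedding S.injective_immersion).isEmbedding⟩

end QuadricData.NormalForm

/-! ### Plane determinants and an enumeration -/

/-- The determinant of two vectors in the plane. -/
def planeDet (v w : Fin 2 → ℝ) : ℝ := v 0 * w 1 - v 1 * w 0

theorem planeDet_self (v : Fin 2 → ℝ) : planeDet v v = 0 := by
  unfold planeDet; ring

theorem planeDet_swap (v w : Fin 2 → ℝ) : planeDet v w = -planeDet w v := by
  unfold planeDet; ring

theorem planeDet_sum_left {ι : Type*} [Fintype ι] (y : ι → ℝ) (v : ι → Fin 2 → ℝ)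
    (w : Fin 2 → ℝ) : planeDet (∑ i, y i • v i) w = ∑ i, y i * planeDet (v i) w := by
  simp only [planeDet, Finset.sum_apply, Pi.smul_apply, smul_eq_mul, Finset.sum_mul,
    ← Finset.sum_sub_distrib]
  exact Finset.sum_congr rfl fun i _ => by ring

/-- Cramer's rule with the denominator cleared: the linear relation between any three plane vectors,
valid also for parallel ones. -/
theorem planeDet_smul_eq (v w x : Fin 2 → ℝ) :
    planeDet v w • x = planeDet x w • v + planeDet v x • w := by
  ext i
  fin_cases i <;> simp [planeDet] <;> ring

theorem eq_add_smul_of_planeDet_ne_zero {v w : Fin 2 → ℝ} (h : planeDet v w ≠ 0)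
    (x : Fin 2 → ℝ) :
    x = (planeDet x w / planeDet v w) • v + (planeDet v x / planeDet v w) • w := by
  rw [div_eq_inv_mul, div_eq_inv_mul, mul_smul, mul_smul, ← smul_add, ← planeDet_smul_eq,
    smul_smul, inv_mul_cancel₀ h, one_smul]

/-- Enumerate a finite type so that the elements with a given property come first. -/
theorem exists_equiv_fin_lt_iff {α : Type*} [Finite α] (O : α → Prop) :
    ∃ (k l : ℕ) (e : Fin (k + l) ≃ α), ∀ i : Fin (k + l), (i : ℕ) < k ↔ O (e i) := by
  classical
  have := Fintype.ofFinite α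
  refine ⟨_, _, finSumFinEquiv.symm.trans (((Fintype.equivFin {x // O x}).symm.sumCongr
    (Fintype.equivFin {x // ¬ O x}).symm).trans (Equiv.sumCompl O)), fun i => ?_⟩
  obtain ⟨i, rfl⟩ := finSumFinEquiv.surjective i
  rcases i with i | i
  · simpa using ((Fintype.equivFin {x // O x}).symm i).2
  · simpa using ((Fintype.equivFin {x // ¬ O x}).symm i).2

/-! ### Consequences of injectivity and compactness -/

namespace QuadricData

section Lattice

variable {m d : ℕ} (Q : QuadricData m d)

/-- If `i_Γ` is injective, then for `u ∈ R_Γ` the vectors `γₖ` with `uₖ ≠ 0` generate the lattice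
`L`: a vector that pairs integrally with them pairs integrally with all `γₖ`. -/
theorem exists_int_dotProduct_eq (hinj : Function.Injective Q.immersion) (u : Q.R)
    (ψ : Fin d → ℝ) (hψ : ∀ k, u.1 k ≠ 0 → ∃ n : ℤ, Q.γ k ⬝ᵥ ψ = n) (k : Fin m) :
    ∃ n : ℤ, Q.γ k ⬝ᵥ ψ = n := by
  set t := Q.torusPoint ((1 / 2 : ℝ) • ψ) with ht
  have htt : ∀ k, t k * t k = Complex.exp (2 * Real.pi * Complex.I * ((Q.γ k ⬝ᵥ ψ : ℝ) : ℂ)) := by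
    intro k
    rw [← Pi.mul_apply, ht, ← torusPoint_add, ← add_smul, show (1 / 2 + 1 / 2 : ℝ) = 1 by norm_num,
      one_smul, torusPoint]
  have hone : ∀ k, t k * t k = 1 ↔ ∃ n : ℤ, Q.γ k ⬝ᵥ ψ = n := by
    intro k
    have h0 : (1 : ℂ) = Complex.exp (2 * Real.pi * Complex.I * ((0 : ℝ) : ℂ)) := by simp
    rw [htt, h0, exp_eq_iff]
    simp
  have hτ : ∀ k, ∃ τ : ℤˣ, u.1 k ≠ 0 → ((τ : ℤ) : ℂ) = t k := by
    intro k
    by_cases hk : u.1 k = 0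
    · exact ⟨1, fun h => absurd hk h⟩
    · rcases mul_self_eq_one_iff.1 ((hone k).2 (hψ k hk)) with h | h
      · exact ⟨1, fun _ => by simp [h]⟩
      · exact ⟨-1, fun _ => by simp [h]⟩
  choose τ hτ using hτ
  -- Where u ≠ 0 the entries of t are signs τ, so (u, t) and (τu, 1) have the same image.
  -- Injectivity then gives an element of D_Γ equal to t, so all entries of t are signs, including
  -- those where u vanishes.
  let u' : Q.R := ⟨fun k => ((τ k : ℤ) : ℝ) * u.1 k, by
    have h : ∀ k, (((τ k : ℤ) : ℝ) * u.1 k) ^ 2 = u.1 k ^ 2 := fun k => by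
      rcases Int.units_eq_one_or (τ k) with h | h <;> simp [h]
    have := u.2
    simp only [R, Set.mem_ofPred_eq, h] at this ⊢
    exact this⟩
  let x : Q.R × Q.T := (u, ⟨t, _, rfl⟩)
  let x' : Q.R × Q.T := (u', ⟨Q.torusPoint 0, _, rfl⟩)
  have hx : Q.proj x = Q.proj x' := by
    refine hinj ?_
    rw [Q.immersion_proj, Q.immersion_proj]
    funext k
    change (u.1 k : ℂ) * t k = (((τ k : ℤ) : ℝ) * u.1 k : ℝ) * Q.torusPoint 0 k
    by_cases hk : u.1 k = 0
    · simp [hk]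
    · rw [← hτ k hk]
      simp [torusPoint, mul_comm]
  obtain ⟨ε, hε⟩ := (Q.proj_eq_iff _ _).1 hx
  have h1 : ((ε.1 k : ℤ) : ℂ) * Q.torusPoint 0 k = t k :=
    congrFun (congrArg (fun y : Q.R × Q.T => y.2.1) hε) k
  refine (hone k).1 ?_
  rw [← h1]
  rcases Int.units_eq_one_or (ε.1 k) with h | h <;> simp [h, torusPoint]

theorem exists_nonneg_sum_eq : ∃ y : Fin m → ℝ, (∀ k, 0 ≤ y k) ∧ ∑ k, y k • Q.γ k = Q.c := by
  obtain ⟨y, hy⟩ := (Submodule.mem_span_range_iff_exists_fun _).1 Q.mem_cone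
  exact ⟨fun k => (y k).1, fun k => (y k).2, hy⟩

/-- If `N_Γ` is compact, then there is no nontrivial relation with nonnegative coefficients. -/
theorem eq_zero_of_sum_eq_zero [CompactSpace Q.N] {w : Fin m → ℝ} (hw : ∀ k, 0 ≤ w k)
    (h : ∑ k, w k • Q.γ k = 0) (k : Fin m) : w k = 0 := by
  by_contra hk
  have hwk : 0 < w k := lt_of_le_of_ne (hw k) (Ne.symm hk)
  obtain ⟨B, hB⟩ := (isCompact_range Q.continuous_immersion).isBounded.exists_norm_le
  have hB' : ∀ u ∈ Q.R, |u k| ≤ B := by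
    intro u hu
    have h1 := hB _ ⟨Q.proj (⟨u, hu⟩, ⟨Q.torusPoint 0, _, rfl⟩), rfl⟩
    rw [Q.immersion_proj] at h1
    have h2 := (norm_le_pi_norm _ k).trans h1
    simpa [norm_mul, norm_torusPoint] using h2
  obtain ⟨y, hy, hyc⟩ := Q.exists_nonneg_sum_eq
  -- Adding `s` times the relation to a solution keeps it a solution; this `s` makes the square of
  -- its `k`-th coordinate at least (B + 1)², beyond the bound.
  let s := (B + 1) ^ 2 / w k
  have hs : 0 ≤ s := div_nonneg (sq_nonneg _) hwk.le
  have hpos : ∀ l, 0 ≤ y l + s * w l := fun l => add_nonneg (hy l) (mul_nonneg hs (hw l))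
  have hmem : (fun l => √(y l + s * w l)) ∈ Q.R := by
    simp only [R, Set.mem_ofPred_eq, Real.sq_sqrt (hpos _), add_smul, mul_smul,
      Finset.sum_add_distrib, ← Finset.smul_sum, h, hyc, smul_zero, add_zero]
  have h1 := hB' _ hmem
  have h0 : 0 ≤ B := (abs_nonneg _).trans h1
  rw [abs_of_nonneg (Real.sqrt_nonneg _)] at h1
  have h2 : s * w k = (B + 1) ^ 2 := div_mul_cancel₀ _ hk
  have h3 : √((B + 1) ^ 2) ≤ √(y k + s * w k) := Real.sqrt_le_sqrt (by linarith [hy k])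
  rw [Real.sqrt_sq (by linarith)] at h3
  linarith

end Lattice

variable {m : ℕ} {Q : QuadricData m 2}

theorem c_ne_zero (Q : QuadricData m 2) : Q.c ≠ 0 := by
  intro h
  have := Q.le_card ∅ (by rw [h]; exact Submodule.zero_mem _)
  simp at this

/-- Suppose γₖ = r·c. If r > 0, then c lies in the cone of a single vector, against `le_card`. If r
≤ 0, then γₖ + (−r)c = 0, with c expanded in the γ's, is a nontrivial nonnegative relation, against
compactness. -/
theorem planeDet_γ_c_ne_zero [CompactSpace Q.N] (k : Fin m) : planeDet (Q.γ k) Q.c ≠ 0 := by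
  intro h
  obtain ⟨r, hr⟩ : ∃ r : ℝ, Q.γ k = r • Q.c := by
    unfold planeDet at h
    by_cases h0 : Q.c 0 = 0
    · have h1 : Q.c 1 ≠ 0 := fun h1 => Q.c_ne_zero (by ext i; fin_cases i <;> simp [h0, h1])
      refine ⟨Q.γ k 1 / Q.c 1, ?_⟩
      ext i
      fin_cases i
      · simp only [h0] at h
        simpa [h0, h1] using h
      · simp [h1]
    · refine ⟨Q.γ k 0 / Q.c 0, ?_⟩
      ext i
      fin_cases i
      · simp [h0]
      · simp only [Fin.mk_one, Pi.smul_apply, smul_eq_mul]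
        field_simp
        linarith
  rcases lt_or_ge 0 r with hr0 | hr0
  · have := Q.le_card {k} (by
      have h1 : Q.c = (⟨r⁻¹, (inv_pos.2 hr0).le⟩ : {r : ℝ // 0 ≤ r}) • Q.γ k := by
        change Q.c = r⁻¹ • Q.γ k
        rw [hr, smul_smul, inv_mul_cancel₀ hr0.ne', one_smul]
      rw [h1]
      exact Submodule.smul_mem _ _ (Submodule.subset_span ⟨k, by simp, rfl⟩))
    simp at this
  · obtain ⟨y, hy, hyc⟩ := Q.exists_nonneg_sum_eq
    have hnn : ∀ l, 0 ≤ (Pi.single k 1 : Fin m → ℝ) l := fun l => by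
      rw [Pi.single_apply]; split_ifs <;> norm_num
    have h1 := Q.eq_zero_of_sum_eq_zero (w := fun l => (Pi.single k 1 : Fin m → ℝ) l + (-r) * y l)
      (fun l => add_nonneg (hnn l) (mul_nonneg (neg_nonneg.2 hr0) (hy l))) (by
        simp only [add_smul, Finset.sum_add_distrib, mul_smul, ← Finset.smul_sum, hyc]
        simp [Pi.single_apply, hr]) k
    simp only [Pi.single_eq_same] at h1
    have := mul_nonneg (neg_nonneg.2 hr0) (hy k)
    linarith

/-- There are vectors on both sides of `c`. -/
theorem exists_planeDet_pos (Q : QuadricData m 2) [CompactSpace Q.N] :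
    (∃ i, 0 < planeDet (Q.γ i) Q.c) ∧ ∃ j, planeDet (Q.γ j) Q.c < 0 := by
  obtain ⟨y, hy, hyc⟩ := Q.exists_nonneg_sum_eq
  -- This is det(c, c) = 0 with the first c expanded. The y's are nonnegative and not all zero and
  -- no determinant vanishes, so both signs occur.
  have h0 : ∑ k, y k * planeDet (Q.γ k) Q.c = 0 := by
    rw [← planeDet_sum_left, hyc, planeDet_self]
  have hne : ∃ k, y k ≠ 0 := by
    by_contra! hcon
    exact Q.c_ne_zero (by rw [← hyc]; simp [hcon])
  obtain ⟨k, hk⟩ := hne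
  constructor <;> by_contra! hcon
  · have := (Finset.sum_eq_zero_iff_of_nonpos fun l _ =>
      mul_nonpos_of_nonneg_of_nonpos (hy l) (hcon l)).1 h0 k (Finset.mem_univ _)
    exact mul_ne_zero hk (planeDet_γ_c_ne_zero k) this
  · have := (Finset.sum_eq_zero_iff_of_nonneg fun l _ =>
      mul_nonneg (hy l) (hcon l)).1 h0 k (Finset.mem_univ _)
    exact mul_ne_zero hk (planeDet_γ_c_ne_zero k) this

/-- With δ = det(γᵢ, γⱼ), the identity det(c, γⱼ)γᵢ + det(γᵢ, c)γⱼ − δc = 0 would, for δ ≤ 0 and c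
expanded in the γ's, be a nontrivial nonnegative relation. -/
theorem planeDet_γ_γ_pos [CompactSpace Q.N] {i j : Fin m} (hi : 0 < planeDet (Q.γ i) Q.c)
    (hj : planeDet (Q.γ j) Q.c < 0) : 0 < planeDet (Q.γ i) (Q.γ j) := by
  by_contra! hcon
  obtain ⟨y, hy, hyc⟩ := Q.exists_nonneg_sum_eq
  have hij : i ≠ j := by rintro rfl; exact lt_asymm hi hj
  set δ := planeDet (Q.γ i) (Q.γ j)
  have hj' : 0 < planeDet Q.c (Q.γ j) := by rw [planeDet_swap]; linarith
  have hnn : ∀ (r : ℝ) (k l : Fin m), 0 < r → 0 ≤ (Pi.single k r : Fin m → ℝ) l := by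
    intro r k l hr
    rw [Pi.single_apply]; split_ifs <;> linarith
  have h1 := Q.eq_zero_of_sum_eq_zero
    (w := fun l => (Pi.single i (planeDet Q.c (Q.γ j)) : Fin m → ℝ) l +
      (Pi.single j (planeDet (Q.γ i) Q.c) : Fin m → ℝ) l + (-δ) * y l)
    (fun l => add_nonneg (add_nonneg (hnn _ _ _ hj') (hnn _ _ _ hi))
      (mul_nonneg (neg_nonneg.2 hcon) (hy l))) (by
      simp only [add_smul, Finset.sum_add_distrib, mul_smul, ← Finset.smul_sum, hyc]
      simp [Pi.single_apply, ← planeDet_smul_eq, δ]) i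
  simp only [Pi.single_eq_same, Pi.single_eq_of_ne hij, add_zero] at h1
  have := mul_nonneg (neg_nonneg.2 hcon) (hy i)
  linarith

/-- If `i_Γ` is injective, then two vectors on different sides of `c` form a basis of the lattice. -/
theorem exists_int_planeDet_eq [CompactSpace Q.N] (hinj : Function.Injective Q.immersion)
    {i j : Fin m} (hi : 0 < planeDet (Q.γ i) Q.c) (hj : planeDet (Q.γ j) Q.c < 0) (k : Fin m) :
    (∃ n : ℤ, planeDet (Q.γ k) (Q.γ j) = n * planeDet (Q.γ i) (Q.γ j)) ∧
      ∃ n : ℤ, planeDet (Q.γ i) (Q.γ k) = n * planeDet (Q.γ i) (Q.γ j) := by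
  have hδ := planeDet_γ_γ_pos hi hj
  have hij : i ≠ j := by rintro rfl; exact lt_asymm hi hj
  set δ := planeDet (Q.γ i) (Q.γ j) with hδdef
  have hj' : 0 < planeDet Q.c (Q.γ j) := by rw [planeDet_swap]; linarith
  -- The coefficients of c in the basis γᵢ, γⱼ are positive; their square roots form a point of R_Γ
  -- supported on {i, j}.
  let v : Fin m → ℝ := fun l => (Pi.single i (planeDet Q.c (Q.γ j) / δ) : Fin m → ℝ) l +
    (Pi.single j (planeDet (Q.γ i) Q.c / δ) : Fin m → ℝ) l
  have hv : ∀ l, 0 ≤ v l := by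
    have hnn : ∀ (r : ℝ) (k l : Fin m), 0 < r → 0 ≤ (Pi.single k r : Fin m → ℝ) l := by
      intro r k l hr
      rw [Pi.single_apply]; split_ifs <;> linarith
    exact fun l => add_nonneg (hnn _ _ _ (div_pos hj' hδ)) (hnn _ _ _ (div_pos hi hδ))
  have hu : (fun l => √(v l)) ∈ Q.R := by
    simp only [R, Set.mem_ofPred_eq, Real.sq_sqrt (hv _)]
    simp only [v, add_smul, Finset.sum_add_distrib]
    conv_rhs => rw [eq_add_smul_of_planeDet_ne_zero (v := Q.γ i) (w := Q.γ j) hδ.ne' Q.c]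
    simp [Pi.single_apply, hδdef]
  have hsupp : ∀ l, √(v l) ≠ 0 → l = i ∨ l = j := by
    intro l hl
    by_contra! hcon
    exact hl (by simp [v, Pi.single_eq_of_ne hcon.1, Pi.single_eq_of_ne hcon.2])
  -- These two vectors are the dual basis of γᵢ, γⱼ, so pairing with them gives coordinates as
  -- quotients of determinants.
  have hdual : ∀ x : Fin 2 → ℝ, x ⬝ᵥ ![Q.γ j 1 / δ, -(Q.γ j 0 / δ)] = planeDet x (Q.γ j) / δ ∧
      x ⬝ᵥ ![-(Q.γ i 1 / δ), Q.γ i 0 / δ] = planeDet (Q.γ i) x / δ := by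
    intro x
    constructor <;>
    · simp only [dotProduct, Fin.sum_univ_two, Matrix.cons_val_zero, Matrix.cons_val_one, planeDet]
      ring
  constructor
  · obtain ⟨n, hn⟩ := Q.exists_int_dotProduct_eq hinj ⟨_, hu⟩
      ![Q.γ j 1 / δ, -(Q.γ j 0 / δ)] (fun l hl => by
        rw [(hdual _).1]
        rcases hsupp l hl with rfl | rfl
        · exact ⟨1, by rw [← hδdef, div_self hδ.ne']; simp⟩
        · exact ⟨0, by rw [planeDet_self]; simp⟩) k
    rw [(hdual _).1, div_eq_iff hδ.ne'] at hn
    exact ⟨n, hn⟩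
  · obtain ⟨n, hn⟩ := Q.exists_int_dotProduct_eq hinj ⟨_, hu⟩
      ![-(Q.γ i 1 / δ), Q.γ i 0 / δ] (fun l hl => by
        rw [(hdual _).2]
        rcases hsupp l hl with rfl | rfl
        · exact ⟨0, by rw [planeDet_self]; simp⟩
        · exact ⟨1, by rw [← hδdef, div_self hδ.ne']; simp⟩) k
    rw [(hdual _).2, div_eq_iff hδ.ne'] at hn
    exact ⟨n, hn⟩

/-- Positivity forces both integers to be at least 1, so each number is at least the other. -/
theorem eq_of_eq_int_mul {x y : ℝ} (hx : 0 < x) (hy : 0 < y) {a b : ℤ} (h1 : x = a * y)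
    (h2 : y = b * x) : x = y := by
  have ha : (0 : ℝ) < a := pos_of_mul_pos_left (h1 ▸ hx) hy.le
  have hb : (0 : ℝ) < b := pos_of_mul_pos_left (h2 ▸ hy) hx.le
  have ha1 : (1 : ℝ) ≤ a := by
    have h : 0 < a := by exact_mod_cast ha
    exact_mod_cast h
  have hb1 : (1 : ℝ) ≤ b := by
    have h : 0 < b := by exact_mod_cast hb
    exact_mod_cast h
  nlinarith

/-! ### Reduction to a normal form -/

/-- A normal form with the odd coefficients first. -/
theorem exists_normalForm (P : Fin m → Prop) {i₀ j₀ : Fin m} (hi₀ : P i₀) (hj₀ : ¬ P j₀)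
    (hdet : planeDet (Q.γ i₀) (Q.γ j₀) ≠ 0) {c₁ c₂ : ℝ} (hc : Q.c = c₁ • Q.γ i₀ + c₂ • Q.γ j₀)
    (hc₁ : 0 < c₁) (hP : ∀ i, P i → ∃ a : ℤ, Q.γ i = Q.γ i₀ + (a : ℝ) • Q.γ j₀ ∧ a * c₁ < c₂)
    (hnP : ∀ j, ¬ P j → Q.γ j = Q.γ j₀) :
    ∃ k p q : ℕ, p + q = m ∧ 0 < p ∧ p < m ∧ k ≤ p ∧
      ∃ S : Q.NormalForm p q, ∀ i : Fin p, (i : ℕ) < k ↔ Odd (S.a i) := by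
  classical
  choose a ha using hP
  -- Here `k` counts the odd coefficients and `l` the even ones, so p = k + l.
  obtain ⟨k, l, e, he⟩ := exists_equiv_fin_lt_iff fun i : {i // P i} => Odd (a i.1 i.2)
  let q := Fintype.card {j // ¬ P j}
  let e' : Fin q ≃ {j // ¬ P j} := (Fintype.equivFin _).symm
  let σ : Fin (k + l) ⊕ Fin q ≃ Fin m := (e.sumCongr e').trans (Equiv.sumCompl P)
  have hcard : k + l + q = m := by simpa using Fintype.card_congr σ
  have hp : 0 < k + l := Fin.pos (e.symm ⟨i₀, hi₀⟩)
  have hq : 0 < q := Fin.pos (e'.symm ⟨j₀, hj₀⟩)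
  exact ⟨k, k + l, q, hcard, hp, by omega, by omega,
    { σ := σ
      a := fun i => a (e i).1 (e i).2
      e₁ := Q.γ i₀
      e₂ := Q.γ j₀
      c₁ := c₁
      c₂ := c₂
      det_ne_zero := hdet
      γ_inl := fun i => (ha _ (e i).2).1
      γ_inr := fun j => hnP _ (e' j).2
      c_eq := hc
      c₁_pos := hc₁
      lt_c₂ := fun i => (ha _ (e i).2).2
      i₀ := e.symm ⟨i₀, hi₀⟩
      j₀ := e'.symm ⟨j₀, hj₀⟩ }, he⟩

/-- Every pair of vectors from opposite sides of c is a basis of L, so all cross determinants agree.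
This rigidity makes at least one side consist of copies of a single vector, which becomes e₂. -/
theorem exists_normalForm_of_injective [CompactSpace Q.N]
    (hinj : Function.Injective Q.immersion) :
    ∃ k p q : ℕ, p + q = m ∧ 0 < p ∧ p < m ∧ k ≤ p ∧
      ∃ S : Q.NormalForm p q, ∀ i : Fin p, (i : ℕ) < k ↔ Odd (S.a i) := by
  obtain ⟨⟨i₀, hi₀⟩, j₀, hj₀⟩ := Q.exists_planeDet_pos
  have hδ := planeDet_γ_γ_pos hi₀ hj₀
  set δ := planeDet (Q.γ i₀) (Q.γ j₀) with hδdef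
  have hneg : ∀ j, ¬ 0 < planeDet (Q.γ j) Q.c → planeDet (Q.γ j) Q.c < 0 := fun j hj =>
    lt_of_le_of_ne (not_lt.1 hj) (planeDet_γ_c_ne_zero j)
  have hrow : ∀ i i' j, 0 < planeDet (Q.γ i) Q.c → 0 < planeDet (Q.γ i') Q.c →
      planeDet (Q.γ j) Q.c < 0 → planeDet (Q.γ i) (Q.γ j) = planeDet (Q.γ i') (Q.γ j) := by
    intro i i' j hi hi' hj
    obtain ⟨⟨n, hn⟩, -⟩ := exists_int_planeDet_eq hinj hi' hj i
    obtain ⟨⟨n', hn'⟩, -⟩ := exists_int_planeDet_eq hinj hi hj i'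
    exact eq_of_eq_int_mul (planeDet_γ_γ_pos hi hj) (planeDet_γ_γ_pos hi' hj) hn hn'
  have hcol : ∀ i j j', 0 < planeDet (Q.γ i) Q.c → planeDet (Q.γ j) Q.c < 0 →
      planeDet (Q.γ j') Q.c < 0 → planeDet (Q.γ i) (Q.γ j) = planeDet (Q.γ i) (Q.γ j') := by
    intro i j j' hi hj hj'
    obtain ⟨-, n, hn⟩ := exists_int_planeDet_eq hinj hi hj' j
    obtain ⟨-, n', hn'⟩ := exists_int_planeDet_eq hinj hi hj j'
    exact eq_of_eq_int_mul (planeDet_γ_γ_pos hi hj) (planeDet_γ_γ_pos hi hj') hn hn'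
  have hleft : ∀ i, 0 < planeDet (Q.γ i) Q.c → ∃ a : ℤ, Q.γ i = Q.γ i₀ + (a : ℝ) • Q.γ j₀ := by
    intro i hi
    obtain ⟨-, a, ha⟩ := exists_int_planeDet_eq hinj hi₀ hj₀ i
    refine ⟨a, ?_⟩
    have h1 := eq_add_smul_of_planeDet_ne_zero hδ.ne' (Q.γ i)
    rwa [ha, hrow i i₀ j₀ hi hi₀ hj₀, ← hδdef, div_self hδ.ne', mul_div_cancel_right₀ _ hδ.ne',
      one_smul] at h1
  have hright : ∀ j, ¬ 0 < planeDet (Q.γ j) Q.c →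
      ∃ b : ℤ, Q.γ j = Q.γ j₀ + (b : ℝ) • Q.γ i₀ := by
    intro j hj
    obtain ⟨⟨b, hb⟩, -⟩ := exists_int_planeDet_eq hinj hi₀ hj₀ j
    refine ⟨b, ?_⟩
    have h1 := eq_add_smul_of_planeDet_ne_zero hδ.ne' (Q.γ j)
    rwa [hb, hcol i₀ j j₀ hi₀ (hneg j hj) hj₀, ← hδdef, div_self hδ.ne',
      mul_div_cancel_right₀ _ hδ.ne', one_smul, add_comm] at h1
  have hc := eq_add_smul_of_planeDet_ne_zero hδ.ne' Q.c
  have hc₁ : 0 < planeDet Q.c (Q.γ j₀) / δ :=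
    div_pos (by rw [planeDet_swap]; linarith) hδ
  have hc₂ : 0 < planeDet (Q.γ i₀) Q.c / δ := div_pos hi₀ hδ
  rw [← hδdef] at hc
  set c₁ := planeDet Q.c (Q.γ j₀) / δ
  set c₂ := planeDet (Q.γ i₀) Q.c / δ
  have hlt₁ : ∀ i (a : ℝ), 0 < planeDet (Q.γ i) Q.c → Q.γ i = Q.γ i₀ + a • Q.γ j₀ →
      a * c₁ < c₂ := by
    intro i a hi ha
    have h1 : planeDet (Q.γ i) Q.c = (c₂ - a * c₁) * δ := by
      rw [ha, hc, hδdef]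
      simp only [planeDet, Pi.add_apply, Pi.smul_apply, smul_eq_mul]
      ring
    rw [h1] at hi
    linarith [pos_of_mul_pos_left hi hδ.le]
  have hlt₂ : ∀ j (b : ℝ), ¬ 0 < planeDet (Q.γ j) Q.c → Q.γ j = Q.γ j₀ + b • Q.γ i₀ →
      b * c₂ < c₁ := by
    intro j b hj hb
    have hj := hneg j hj
    have h1 : planeDet (Q.γ j) Q.c = -((c₁ - b * c₂) * δ) := by
      rw [hb, hc, hδdef]
      simp only [planeDet, Pi.add_apply, Pi.smul_apply, smul_eq_mul]
      ring
    rw [h1, neg_lt_zero] at hj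
    linarith [pos_of_mul_pos_left hj hδ.le]
  -- If one side is constant it supplies e₂. Otherwise a vector with b ≠ 0 on that side forces a = 0
  -- for everything on the other, and the two sides exchange roles.
  by_cases hall : ∀ j, ¬ 0 < planeDet (Q.γ j) Q.c → Q.γ j = Q.γ j₀
  · refine exists_normalForm (fun i => 0 < planeDet (Q.γ i) Q.c) hi₀ hj₀.not_gt hδ.ne' hc hc₁
      (fun i hi => ?_) hall
    obtain ⟨a, ha⟩ := hleft i hi
    exact ⟨a, ha, hlt₁ i a hi ha⟩
  · push Not at hall
    obtain ⟨j, hj, hjne⟩ := hall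
    obtain ⟨b, hb⟩ := hright j (not_lt.2 hj)
    have hb0 : (b : ℝ) ≠ 0 := fun h => hjne (by rw [hb, h, zero_smul, add_zero])
    refine exists_normalForm (fun i => ¬ 0 < planeDet (Q.γ i) Q.c) hj₀.not_gt (not_not.2 hi₀)
      (by rw [planeDet_swap]; exact neg_ne_zero.2 hδ.ne') (hc.trans (add_comm _ _)) hc₂
      (fun i hi => ?_) fun i hi => ?_
    · obtain ⟨a, ha⟩ := hright i hi
      exact ⟨a, ha, hlt₂ i a hi ha⟩
    · have hi := not_not.1 hi
      obtain ⟨a, ha⟩ := hleft i hi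
      -- The same determinant equals δ, so ab = 0.
      have h1 : planeDet (Q.γ i) (Q.γ j) = (1 - a * b) * δ := by
        rw [ha, hb, hδdef]
        simp only [planeDet, Pi.add_apply, Pi.smul_apply, smul_eq_mul]
        ring
      rw [hrow i i₀ j hi hi₀ (hneg j (not_lt.2 hj)), hcol i₀ j j₀ hi₀ (hneg j (not_lt.2 hj)) hj₀,
        ← hδdef] at h1
      have h2 : (a : ℝ) * b = 0 := by
        have h3 : (1 - (a : ℝ) * b) = 1 := mul_right_cancel₀ hδ.ne' (by rw [← h1, one_mul])
        linarith
      rw [ha, (mul_eq_zero.1 h2).resolve_right hb0, zero_smul, add_zero]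

end QuadricData

/-! ### The standard configurations and the converse -/

/-- The configuration of `k` vectors `(1, 1)`, `p - k` vectors `(1, 0)` and `q` vectors `(0, 1)`. -/
def standardConfiguration (k p q : ℕ) (l : Fin (p + q)) : Fin 2 → ℝ :=
  Sum.elim (fun i : Fin p => ![1, if (i : ℕ) < k then 1 else 0]) (fun _ : Fin q => ![0, 1])
    (finSumFinEquiv.symm l)

theorem standardConfiguration_inl (k p q : ℕ) (i : Fin p) :
    standardConfiguration k p q (finSumFinEquiv (Sum.inl i)) =
      ![1, if (i : ℕ) < k then 1 else 0] := by
  simp only [standardConfiguration, Equiv.symm_apply_apply, Sum.elim_inl]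

theorem standardConfiguration_inr (k p q : ℕ) (j : Fin q) :
    standardConfiguration k p q (finSumFinEquiv (Sum.inr j)) = ![0, 1] := by
  simp only [standardConfiguration, Equiv.symm_apply_apply, Sum.elim_inr]

/-- The standard configuration with `c = (1, 2)`. -/
def standardQuadricData (k : ℕ) {p q : ℕ} (hp : 0 < p) (hq : 0 < q) : QuadricData (p + q) 2 where
  γ := standardConfiguration k p q
  -- The second coordinate must exceed every aᵢc₁ ≤ 1; the value 2 puts c strictly between (1,1) and
  -- (0,1).
  c := ![1, 2]
  mem_cone := by
    have h1 : standardConfiguration k p q (finSumFinEquiv (Sum.inl ⟨0, hp⟩)) ∈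
        PointedCone.hull ℝ (Set.range (standardConfiguration k p q)) :=
      Submodule.subset_span ⟨_, rfl⟩
    have h2 : standardConfiguration k p q (finSumFinEquiv (Sum.inr ⟨0, hq⟩)) ∈
        PointedCone.hull ℝ (Set.range (standardConfiguration k p q)) :=
      Submodule.subset_span ⟨_, rfl⟩
    have h3 : (![1, 2] : Fin 2 → ℝ) =
        standardConfiguration k p q (finSumFinEquiv (Sum.inl ⟨0, hp⟩)) +
        -- The first vector is (1,1) or (1,0) according as k > 0 or k = 0, and the multiple of (0,1)
        -- completes it to (1,2).
        (⟨if 0 < k then 1 else 2, by split_ifs <;> norm_num⟩ : {r : ℝ // 0 ≤ r}) •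
          standardConfiguration k p q (finSumFinEquiv (Sum.inr ⟨0, hq⟩)) := by
      rw [standardConfiguration_inl, standardConfiguration_inr]
      change _ = _ + (if 0 < k then 1 else 2 : ℝ) • (![0, 1] : Fin 2 → ℝ)
      by_cases hk : 0 < k <;> ext i <;> fin_cases i <;> simp [hk]
      norm_num
    rw [h3]
    exact Submodule.add_mem _ h1 (Submodule.smul_mem _ _ h2)
  le_card I hI := by
    by_contra! hlt
    -- The empty family is absorbed into an arbitrary singleton, so only multiples of one vector
    -- need to be excluded.
    obtain ⟨l, hl⟩ : ∃ l, (I : Set (Fin (p + q))) ⊆ {l} := by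
      rcases I.eq_empty_or_nonempty with rfl | ⟨l, hl⟩
      · exact ⟨Fin.castAdd q ⟨0, hp⟩, by simp⟩
      · exact ⟨l, fun l' hl' => Finset.card_le_one.1 (by omega) _ hl' _ hl⟩
    have h1 : (![1, 2] : Fin 2 → ℝ) ∈ PointedCone.hull ℝ {standardConfiguration k p q l} := by
      refine Submodule.span_mono ?_ hI
      rw [← Set.image_singleton]
      exact Set.image_mono hl
    obtain ⟨⟨r, hr⟩, h2⟩ := Submodule.mem_span_singleton.1 h1
    change r • standardConfiguration k p q l = _ at h2
    have h3 := congrFun h2 0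
    have h4 := congrFun h2 1
    obtain ⟨l, rfl⟩ := finSumFinEquiv.surjective l
    rcases l with i | j
    · rw [standardConfiguration_inl] at h3 h4
      by_cases hk : (i : ℕ) < k <;> simp [hk] at h3 h4
      rw [h3] at h4
      norm_num at h4
    · rw [standardConfiguration_inr] at h3
      simp at h3
  discrete := by
    -- All vectors have integer coordinates, so L is contained in ℤ², which is discrete.
    have h : (Submodule.span ℤ (Set.range (standardConfiguration k p q)) : Set (Fin 2 → ℝ)) ⊆
        Submodule.span ℤ (Set.range (Pi.basisFun ℝ (Fin 2))) := by
      refine Submodule.span_le.2 ?_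
      rintro _ ⟨l, rfl⟩
      have h0 : Pi.basisFun ℝ (Fin 2) 0 ∈ Submodule.span ℤ (Set.range (Pi.basisFun ℝ (Fin 2))) :=
        Submodule.subset_span ⟨0, rfl⟩
      have h1 : Pi.basisFun ℝ (Fin 2) 1 ∈ Submodule.span ℤ (Set.range (Pi.basisFun ℝ (Fin 2))) :=
        Submodule.subset_span ⟨1, rfl⟩
      obtain ⟨l, rfl⟩ := finSumFinEquiv.surjective l
      rcases l with i | j
      · rw [standardConfiguration_inl, SetLike.mem_coe]
        by_cases hk : (i : ℕ) < k
        · rw [show ![1, if (i : ℕ) < k then 1 else 0] = Pi.basisFun ℝ (Fin 2) 0 +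
            Pi.basisFun ℝ (Fin 2) 1 by ext l; fin_cases l <;> simp [hk]]
          exact Submodule.add_mem _ h0 h1
        · rwa [show ![1, if (i : ℕ) < k then 1 else 0] = Pi.basisFun ℝ (Fin 2) 0 by
            ext l; fin_cases l <;> simp [hk]]
      · rw [standardConfiguration_inr, SetLike.mem_coe]
        rwa [show ![0, 1] = Pi.basisFun ℝ (Fin 2) 1 by ext l; fin_cases l <;> simp]
    have hd : DiscreteTopology (Submodule.span ℤ (Set.range (Pi.basisFun ℝ (Fin 2)))) :=
      inferInstance
    exact DiscreteTopology.of_subset (s := (Submodule.span ℤ (Set.range (Pi.basisFun ℝ (Fin 2))) :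
      Set (Fin 2 → ℝ))) hd h

/-- The normal form of the standard configuration. -/
def standardNormalForm (k : ℕ) {p q : ℕ} (hp : 0 < p) (hq : 0 < q) :
    (standardQuadricData k hp hq).NormalForm p q where
  σ := finSumFinEquiv
  a i := if (i : ℕ) < k then 1 else 0
  e₁ := ![1, 0]
  e₂ := ![0, 1]
  c₁ := 1
  c₂ := 2
  det_ne_zero := by simp
  γ_inl i := by
    refine (standardConfiguration_inl k p q i).trans ?_
    by_cases hk : (i : ℕ) < k <;> ext l <;> fin_cases l <;> simp [hk]
  γ_inr j := standardConfiguration_inr k p q j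
  c_eq := by
    simp only [standardQuadricData]
    ext l
    fin_cases l <;> simp
  c₁_pos := one_pos
  lt_c₂ i := by split_ifs <;> norm_num
  i₀ := ⟨0, hp⟩
  j₀ := ⟨0, hq⟩

theorem exists_quadricData (k : ℕ) {p q : ℕ} (hp : 0 < p) (hq : 0 < q) :
    ∃ Q : QuadricData (p + q) 2, CompactSpace Q.N ∧
      Manifold.IsSmoothEmbedding 𝓘(ℝ, EuclideanSpace ℝ (Fin (p + q))) 𝓘(ℝ, Fin (p + q) → ℂ) ∞
        Q.immersion ∧
      Nonempty (Q.N ≃ₘ⟮𝓘(ℝ, EuclideanSpace ℝ (Fin (p + q))),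
        𝓘(ℝ, EuclideanSpace ℝ (Fin (p + q)))⟯ Nkpq k p q) := by
  obtain ⟨e⟩ := (standardNormalForm k hp hq).nonempty_diffeomorph (k := k) fun i => by
    change _ ↔ Odd (if (i : ℕ) < k then (1 : ℤ) else 0)
    split_ifs with h <;> simp [h]
  -- Compactness is carried over from the model, a quotient of a product of spheres and circles; it
  -- then upgrades the injective immersion to an embedding.
  have : CompactSpace (standardQuadricData k hp hq).N := e.toHomeomorph.symm.compactSpace
  exact ⟨standardQuadricData k hp hq, this, (standardNormalForm k hp hq).isSmoothEmbedding_immersion,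
    ⟨e⟩⟩

end

theorem theorem5p7 (m : ℕ) :
    (∀ Q : QuadricData m 2, CompactSpace Q.N →
      Manifold.IsSmoothEmbedding 𝓘(ℝ, EuclideanSpace ℝ (Fin m)) 𝓘(ℝ, Fin m → ℂ) ∞ Q.immersion →
      ∃ k p q : ℕ, p + q = m ∧ 0 < p ∧ p < m ∧ k ≤ p ∧
        Nonempty (Q.N ≃ₘ⟮𝓘(ℝ, EuclideanSpace ℝ (Fin m)), 𝓘(ℝ, EuclideanSpace ℝ (Fin (p + q)))⟯
          Nkpq k p q)) ∧
    (∀ k p q : ℕ, p + q = m → 0 < p → p < m → k ≤ p →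
      ∃ Q : QuadricData m 2, CompactSpace Q.N ∧
        Manifold.IsSmoothEmbedding 𝓘(ℝ, EuclideanSpace ℝ (Fin m)) 𝓘(ℝ, Fin m → ℂ) ∞ Q.immersion ∧
        Nonempty (Q.N ≃ₘ⟮𝓘(ℝ, EuclideanSpace ℝ (Fin m)), 𝓘(ℝ, EuclideanSpace ℝ (Fin (p + q)))⟯
          Nkpq k p q)) := by
  refine ⟨fun Q hcpt hemb => ?_, fun k p q hpq hp hpm _ => ?_⟩
  · obtain ⟨k, p, q, hpq, hp, hpm, hk, S, hS⟩ :=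
      QuadricData.exists_normalForm_of_injective hemb.isEmbedding.injective
    exact ⟨k, p, q, hpq, hp, hpm, hk, S.nonempty_diffeomorph hS⟩
  · subst hpq
    exact exists_quadricData k hp (by omega)
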